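/- **Setting.** Let $V=V_o\sqcup V_h$ be a finite set of observed and hidden nodes and let $G_T$ be a graph on $V$. Let $p_i=(p_i(k))_{k\in\mathbb Z}$, $i\in V$, be zero-mean, mutually uncorrelated ($E[p_i(s)\overline{p_j(t)}]=0$ for $i\ne j$), complex square-integrable processes, $p_i$ being wide-sense cyclostationary of (least) period $T_i$. Put $T=\mathrm{lcm}\{T_i: i\in V_o\}$ and assume that $T_i\mid T$ for every $i\in V_h$. Fix $l\ge 1$ and $\Delta t>0$. The system parameters are $a_{n,i}\in\mathbb C$ ($0\le n\le l$, $i\in V$) and $b_{ij}\in\mathbb C$ (for ordered pairs of adjacent nodes of $G_T$; $b_{ij}=0$ for all other pairs). Put $$S_i(z)=\sum_{n=0}^{l}a_{n,i}\Big(\frac{2(1-z^{-1})}{\Delta t(1+z^{-1})}\Big)^n,\qquad h_{ij}(z)=\frac{b_{ij}}{S_i(z)},\qquad e_i=\frac1{S_i}\,p_i,$$ and consider the linear dynamical model $x_i(k)=\sum_{j\ne i}(h_{ij}*x_j)(k)+e_i(k)$, which is the bilinear (Tustin) discretization of $\sum_{n=0}^{l}a_{n,i}\frac{d^nx_i}{dt^n}=\sum_{j\neq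 i} b_{ij}x_j+p_i$. Transfer functions act through their inverse $z$-transforms on the unit circle, and convolutions converge in $L^2$. For a process $y$ let $Y(k)=[y(kT),\dots,y(kT+T-1)]'$ be its lift, and let $\Phi_Y(\omega)=\sum_k E[Y(k)Y(0)^*]e^{-\iota\omega k}$ be the power spectral density of a lifted process, the correlations of the lifted inputs $P_i$ and of the joint lift of $(x_i)_{i\in V}$ being assumed absolutely summable. Let $\mathcal F=\{\omega\in[0,2\pi): e^{\iota\omega}\neq(-1)^T\}$; the one excluded frequency corresponds to the singular point $z=-1$ of the bilinear transform. **Assumptions.** * No $S_i$ vanishes at a point $z\neq-1$ of the unit circle; the processes $\{x_i,e_i\}_{i\in V}$ are jointly wide-sense cyclostationary with period $T$; and $\Phi_{E_i}(\omega)\succ0$ for all $i\in V$, $\omega\in\mathcal F$ (topological detectability). * The model is bidirected ($h_{ji}\neq0$ implies $h_{ij}\ne0$), and its topology, the undirected graph on $V$ with an edge between $i\ne j$ whenever $h_{ij}\neq0$ or $h_{ji}\ne 0$, is $G_T$. * $G_T$ is a tree, any two distinct hidden nodes are at least four hops apart, and every hidden node is at least three hops away from every leaf (node of degree one) of $G_T$.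 Let $\Phi_{oo}$ be the power spectral density of the joint lift of the observed processes, let $\Phi_{oo}^{-1}(a,b)$ be the $T\times T$ block of its inverse belonging to $a,b\in V_o$, and let $G_c$ be the graph on $V_o$ in which $a\neq b$ are adjacent iff $\Phi_{oo}^{-1}(a,b)$ (equivalently, $\Phi_{oo}^{-1}(b,a)$) is not identically zero on $\mathcal F$. Say that the eigenvalues of $\Phi_{oo}^{-1}(a,b)$ *have constant phase* if there is a $c\in\mathbb R$ such that for every $\omega\in\mathcal F$ every nonzero eigenvalue of $\Phi_{oo}^{-1}(a,b)(\omega)$ has argument $c$. **Theorem.** Fix $V_o,V_h,G_T,l,\Delta t$ and the inputs $p_i$. For all system parameters outside a set of Lebesgue measure zero the following holds for every solution $x$ of the model that satisfies the assumptions: for every observed leaf $a$ and every observed non-leaf $b$ of $G_T$ that are adjacent in $G_c$, the eigenvalues of $\Phi_{oo}^{-1}(a,b)$ have constant phase if and only if $a$ and $b$ are two-hop neighbours in $G_T$ (their distance in $G_T$ is $2$). The direction from two-hop neighbours to constant phase holds for all system parameters, without an exceptional set, and in that case all eigenvalues of $\Phi_{oo}^{-1}(a,b)(\omega)$, $\omega\in\mathcal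 F$, are nonzero. -/

import Mathlib

open MeasureTheory Set

noncomputable section

namespace CycloLDM

/-! ### Second order processes and their power spectral densities -/

section Processes

variable {Ω : Type*} [MeasurableSpace Ω] {P : Measure Ω} {ι : Type*}

/-- The correlation `E[u v̄]` of two square integrable complex random variables. -/
def corr (u v : Lp ℂ 2 P) : ℂ := ∫ o, u o * (starRingEnd ℂ) (v o) ∂P

/-- The mean `E[u]`. -/
def mean (u : Lp ℂ 2 P) : ℂ := ∫ o, u o ∂P

/-- The means and all auto- and cross-correlations of the family are invariant under a time
shift by `τ`. -/
def JointlyPeriodic (τ : ℕ) (y : ι → ℤ → Lp ℂ 2 P) : Prop :=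
  (∀ i t, mean (y i (t + τ)) = mean (y i t)) ∧
  ∀ i j s t, corr (y i (s + τ)) (y j (t + τ)) = corr (y i s) (y j t)

/-- `y` is wide sense cyclostationary of period `τ`: `τ` is the least positive period of its mean
and correlation functions. -/
def IsWSCS (τ : ℕ) (y : ℤ → Lp ℂ 2 P) : Prop :=
  IsLeast {σ : ℕ | 0 < σ ∧ JointlyPeriodic σ (fun _ : Unit => y)} τ

/-- The lifted process `Y(k) = [y(kT), …, y(kT+T-1)]'`. -/
def lift (T : ℕ) (y : ℤ → Lp ℂ 2 P) (s : Fin T) (k : ℤ) : Lp ℂ 2 P := y (k * T + (s : ℕ))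

/-- The lift of a family of processes, as one vector process made of blocks of size `T`. -/
def liftAll (T : ℕ) (y : ι → ℤ → Lp ℂ 2 P) (q : ι × Fin T) (k : ℤ) : Lp ℂ 2 P :=
  lift T (y q.1) q.2 k

/-- The (matrix) correlation sequence of the vector process is absolutely summable, so that its
power spectral density is a well defined function. -/
def HasPSD (Y : ι → ℤ → Lp ℂ 2 P) : Prop :=
  ∀ α β, Summable fun k : ℤ => corr (Y α k) (Y β 0)

/-- The power spectral density `Φ_Y(ω) = ∑ₖ E[Y(k) Y(0)*] e^{-iωk}` of a vector wide sense
stationary process. -/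
def psd (Y : ι → ℤ → Lp ℂ 2 P) (ω : ℝ) : Matrix ι ι ℂ :=
  Matrix.of fun α β =>
    ∑' k : ℤ, corr (Y α k) (Y β 0) * Complex.exp (-(Complex.I * ω * k))

/-- The convolution `(h * y)(k) = ∑ₙ h(n) y(k-n)`, the sum being taken in `L²`. -/
def conv (h : ℤ → ℂ) (y : ℤ → Lp ℂ 2 P) (k : ℤ) : Lp ℂ 2 P := ∑' n : ℤ, h n • y (k - n)

end Processes

/-- The inverse z-transform of `f` on the unit circle:
`h(n) = (1/2π) ∫₀^{2π} f(e^{iω}) e^{inω} dω`. -/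
def invZ (f : ℂ → ℂ) (n : ℤ) : ℂ :=
  (2 * Real.pi : ℂ)⁻¹ *
    ∫ ω in (0 : ℝ)..(2 * Real.pi),
      f (Complex.exp (Complex.I * ω)) * Complex.exp (Complex.I * n * ω)

/-! ### The linear dynamical model -/

/-- System parameters of a network of order `l` whose interactions lie on `G`: the coefficients
`a_{n,i}`, `0 ≤ n ≤ l`, and, for every ordered pair `(i,j)` of adjacent nodes, the weight `b_{ij}`
with which `x_j` enters the equation of `x_i`. -/
abbrev Params {V : Type*} (G : SimpleGraph V) (l : ℕ) : Type _ :=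
  (V → Fin (l + 1) → ℂ) × (G.Dart → ℂ)

section Model

variable {V : Type*} {G : SimpleGraph V} {l : ℕ}

open Classical in
/-- The weight `b_{ij}`, which is zero when `i`, `j` are not adjacent (in particular if `i = j`). -/
def weight (θ : Params G l) (i j : V) : ℂ :=
  if h : G.Adj i j then θ.2 ⟨(i, j), h⟩ else 0

/-- `S_i(z) = ∑ₙ a_{n,i} (2(1-z⁻¹) / (Δt (1+z⁻¹)))ⁿ` (bilinear transform of `∑ₙ a_{n,i} dⁿ/dtⁿ`). -/
def sysS (Δt : ℝ) (θ : Params G l) (i : V) (z : ℂ) : ℂ :=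
  ∑ n : Fin (l + 1), θ.1 i n * (2 * (1 - z⁻¹) / (Δt * (1 + z⁻¹))) ^ (n : ℕ)

/-- The transfer function `h_{ij}(z) = b_{ij} / S_i(z)`. -/
def transfer (Δt : ℝ) (θ : Params G l) (i j : V) (z : ℂ) : ℂ := weight θ i j / sysS Δt θ i z

/-- The topology `G_T`: the undirected graph underlying the linear dynamic graph, whose directed
edges are the `(i,j)` with `h_{ij} ≠ 0`. -/
def topology (Δt : ℝ) (θ : Params G l) : SimpleGraph V :=
  SimpleGraph.fromRel fun i j => transfer Δt θ i j ≠ 0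

/-- The network is bidirected. -/
def Bidirected (Δt : ℝ) (θ : Params G l) : Prop :=
  ∀ i j, transfer Δt θ j i ≠ 0 → transfer Δt θ i j ≠ 0

/-- No transfer function has a pole on the unit circle (the point `-1` corresponds to infinite
continuous frequency; `1 / S_i` is always finite there). -/
def Stable (Δt : ℝ) (θ : Params G l) : Prop :=
  ∀ i, ∀ z : ℂ, ‖z‖ = 1 → z ≠ -1 → sysS Δt θ i z ≠ 0

variable {Ω : Type*} [MeasurableSpace Ω] {P : Measure Ω}

/-- The input `e_i = p_i / S_i` of the discrete time model. -/
def input (Δt : ℝ) (θ : Params G l) (p : V → ℤ → Lp ℂ 2 P) (i : V) : ℤ → Lp ℂ 2 P :=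
  conv (invZ fun z => (sysS Δt θ i z)⁻¹) (p i)

/-- The frequencies of `[0, 2π)` except the single one (mod `2π`) that the lift with period `T`
assigns to `z = -1`. There the bilinear transform is singular, and inverse spectral densities
need not exist. -/
def freqs (T : ℕ) : Set ℝ :=
  {ω | ω ∈ Ico 0 (2 * Real.pi) ∧ Complex.exp (Complex.I * ω) ≠ (-1) ^ T}

open scoped ComplexOrder in
/-- `x` is the collection of states, and `p` the collection of physical inputs, of a stable and
topologically detectable bidirected linear dynamical model with parameters `θ`, topology `G` and
cyclostationary period `T`. -/
structure IsLDM [Fintype V] [DecidableEq V] (Δt : ℝ) (T : ℕ) (θ : Params G l)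
    (p x : V → ℤ → Lp ℂ 2 P) : Prop where
  stable : Stable Δt θ
  bidirected : Bidirected Δt θ
  topology_eq : topology Δt θ = G
  jwscs : JointlyPeriodic T (Sum.elim x (input Δt θ p))
  hasPSD : HasPSD (liftAll T x)
  dynamics : ∀ i k, x i k =
    ∑ j ∈ Finset.univ.erase i, conv (invZ (transfer Δt θ i j)) (x j) k + input Δt θ p i k
  detectable : ∀ i, ∀ ω ∈ freqs T, (psd (lift T (input Δt θ p i)) ω).PosDef

end Model

/-- A leaf is a node of degree one. -/
def IsLeaf {V : Type*} (G : SimpleGraph V) (v : V) : Prop := (G.neighborSet v).ncard = 1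

/-! ### The observed inverse power spectral density -/

section Observed

variable {Ω : Type*} [MeasurableSpace Ω] {P : Measure Ω}
  {Vo Vh : Type*} [Fintype Vo] [DecidableEq Vo]

/-- The power spectral density `Φ_oo` of the lifted observed processes. -/
def psdObs (T : ℕ) (x : Vo ⊕ Vh → ℤ → Lp ℂ 2 P) (ω : ℝ) :
    Matrix (Vo × Fin T) (Vo × Fin T) ℂ :=
  psd (liftAll T fun i : Vo => x (Sum.inl i)) ω

/-- The `T × T` block `Φ_oo⁻¹(a,b)(ω)`. -/
def invBlock (T : ℕ) (x : Vo ⊕ Vh → ℤ → Lp ℂ 2 P) (a b : Vo) (ω : ℝ) :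
    Matrix (Fin T) (Fin T) ℂ :=
  Matrix.of fun s t => (psdObs T x ω)⁻¹ (a, s) (b, t)

/-- The graph `G_c` on the observed nodes, whose edges are the nonzero off-diagonal blocks
of `Φ_oo⁻¹`. -/
def obsGraph (T : ℕ) (x : Vo ⊕ Vh → ℤ → Lp ℂ 2 P) : SimpleGraph Vo :=
  SimpleGraph.fromRel fun a b => ∃ ω ∈ freqs T, invBlock T x a b ω ≠ 0

end Observed

/-- All eigenvalues of `M(ω)`, for all frequencies `ω`, have the same phase (the eigenvalue `0` has
no phase and is not constrained). -/
def ConstantPhase (T : ℕ) (M : ℝ → Matrix (Fin T) (Fin T) ℂ) : Prop :=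
  ∃ c : ℝ, ∀ ω ∈ freqs T, ∀ μ : ℂ,
    Module.End.HasEigenvalue (Matrix.toLin' (M ω)) μ → μ ≠ 0 → μ.arg = c

end CycloLDM

end

noncomputable section

namespace CycloLDM

open scoped Matrix ComplexOrder InnerProductSpace

/-! ### Zeros of real analytic functions -/

/-! In the frequency domain the lifted model reads `(S - B) X = P`, where `S` is block diagonal with
blocks the lifts of the `S_i` and `B` has scalar blocks `b_ij • 1`. Away from the frequency whose
`T`-th roots include `-1` everything is invertible, and `Φ_X⁻¹ = (S - B)* Φ_P⁻¹ (S - B)` with `Φ_P`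
block diagonal (`IsLDM.precision_mul_blockPsd`). The block `(i, j)` of this product only involves
nodes within one hop of both `i` and `j`, so it vanishes at distance at least three. Hidden nodes
are that far from a leaf `a`; hence row `a` of `Φ_oo⁻¹` is simply row `a` of `Φ_X⁻¹`
(`inv_submatrix_of_row_eq_zero`), and every `G_c`-neighbour of `a` lies at distance one or two.

At distance two, the sole contribution comes from the common neighbour `k`: the block is the nonzero
constant `conj(b_ka) b_kb` times the positive definite `Φ_{P_k}⁻¹`, so all eigenvalues are positive
multiples of one number (`eigenvalue_smul_posDef`).

At distance one, constant phase would make the determinants at any two frequencies real multiples of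
one complex number, so one times the conjugate of the other would be real
(`IsLDM.det_adjBlock_im_eq_zero`). At the frequencies `π/2` and `3π/2` the imaginary part of this
product is real analytic in the parameters. An explicit choice of parameters shows that it is not
identically zero, so it is nonzero almost everywhere (`ae_det_adjBlock_im_ne_zero`). Only finitely
many pairs `(a, b)` occur, so one null set serves all of them. -/

theorem ae_ne_zero_of_analytic_on_lines {E : Type*} [NormedAddCommGroup E] [NormedSpace ℝ E]
    [FiniteDimensional ℝ E] [MeasurableSpace E] [BorelSpace E] (μ : Measure E)
    [μ.IsAddHaarMeasure] {F : E → ℝ} (hF : AnalyticOnNhd ℝ F Set.univ) {x₀ : E} (hx₀ : F x₀ ≠ 0) :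
    ∀ᵐ x ∂μ, F x ≠ 0 := by
  have hc : Continuous F := continuousOn_univ.1 hF.continuousOn
  -- On each line through `x₀` the function is analytic and nonzero at `r = 0`, so its zeros are
  -- discrete, hence null.
  have hline : ∀ v : E, volume {r : ℝ | F (x₀ + r • v) = 0} = 0 := by
    intro v
    have hfv : AnalyticOnNhd ℝ (fun r : ℝ => F (x₀ + r • v)) Set.univ := fun r _ =>
      (hF (x₀ + r • v) (Set.mem_univ _)).comp_of_eq (f := fun r : ℝ => x₀ + r • v)
        (by fun_prop) rfl
    have h := hfv.preimage_zero_mem_codiscreteWithin (x := 0) (by simpa using hx₀)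
      (Set.mem_univ _) isConnected_univ
    have h2 := ae_restrict_le_codiscreteWithin (μ := volume) MeasurableSet.univ h
    rw [Measure.restrict_univ] at h2
    rw [← compl_mem_ae_iff]
    filter_upwards [h2] with r hr
    simpa using hr
  have hS : MeasurableSet {q : ℝ × E | F (x₀ + q.1 • q.2) = 0} :=
    (isClosed_eq (by fun_prop) continuous_const).measurableSet
  have h0 : (volume.prod μ) {q : ℝ × E | F (x₀ + q.1 • q.2) = 0} = 0 := by
    rw [Measure.prod_apply_symm hS]
    simp only [Set.preimage_ofPred_eq, hline, lintegral_zero]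
  -- Fubini in the other order: for one fixed `r ≠ 0` almost every `v` is good. Dilation by `r` and
  -- translation by `x₀` preserve null sets, so almost every point of `E` is good.
  have h1 : ∀ᵐ r : ℝ, ∀ᵐ v ∂μ, F (x₀ + r • v) ≠ 0 :=
    Measure.ae_ae_of_ae_prod (compl_mem_ae_iff.2 h0 :
      ∀ᵐ q ∂(volume.prod μ), q ∈ {q : ℝ × E | F (x₀ + q.1 • q.2) = 0}ᶜ)
  obtain ⟨r, hr, hr0⟩ := (h1.and (Measure.ae_ne volume 0)).exists
  have h2 : {v : E | ¬ F (x₀ + r • v) ≠ 0} =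
      (r • ·) ⁻¹' ((x₀ + ·) ⁻¹' {x | ¬ F x ≠ 0}) := rfl
  rw [ae_iff, h2, Measure.addHaar_preimage_smul μ hr0, measure_preimage_add, mul_eq_zero] at hr
  refine ae_iff.2 (hr.resolve_left ?_)
  simpa using pow_pos (abs_pos.2 hr0) _

/-! ### Linear algebra -/

/-- The determinant is the product of the characteristic roots with multiplicity, each of the form
`‖μ‖ e^{ic}`; a zero root fits with modulus zero. -/
theorem det_of_eigenvalues_arg_eq {n : Type*} [Fintype n] [DecidableEq n] (M : Matrix n n ℂ)
    {c : ℝ} (h : ∀ μ : ℂ, Module.End.HasEigenvalue (Matrix.toLin' M) μ → μ ≠ 0 → μ.arg = c) :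
    ∃ r : ℝ, M.det = r * Complex.exp (Complex.I * c) ^ Fintype.card n := by
  have hr : ∀ μ ∈ M.charpoly.roots, μ = ‖μ‖ * Complex.exp (Complex.I * c) := by
    intro μ hμ
    by_cases h0 : μ = 0
    · simp [h0]
    · have h1 : Module.End.HasEigenvalue (Matrix.toLin' M) μ := by
        rw [Module.End.hasEigenvalue_iff_isRoot_charpoly, Matrix.charpoly_toLin']
        exact Polynomial.isRoot_of_mem_roots hμ
      rw [← h μ h1 h0, mul_comm Complex.I, Complex.norm_mul_exp_arg_mul_I]
  have hcard : M.charpoly.roots.card = Fintype.card n := by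
    rw [← (IsAlgClosed.splits M.charpoly).natDegree_eq_card_roots, Matrix.charpoly_natDegree_eq_dim]
  rw [Matrix.det_eq_prod_roots_charpoly, ← hcard]
  generalize M.charpoly.roots = s at hr
  clear hcard
  induction s using Multiset.induction_on with
  | empty => exact ⟨1, by simp⟩
  | cons a s ih =>
    obtain ⟨r, h⟩ := ih fun μ hμ => hr μ (Multiset.mem_cons_of_mem hμ)
    refine ⟨‖a‖ * r, ?_⟩
    rw [Multiset.prod_cons, h, Multiset.card_cons, pow_succ,
      hr a (Multiset.mem_cons_self a s)]
    simp only [Complex.norm_mul, Complex.norm_real, norm_norm, mul_comm Complex.I,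
      Complex.norm_exp_ofReal_mul_I]
    push_cast
    ring

/-- Passing to a submatrix normally adds a Schur complement to the inverse. A row of `K` supported
on the retained indices escapes it: restricting `K * Φ = 1` to that row already exhibits it as a row
of the inverse. -/
theorem inv_submatrix_of_row_eq_zero {m n k : Type*} [Fintype m] [DecidableEq m] [Fintype n]
    [DecidableEq n] [Fintype k] {Φ K : Matrix m m ℂ} (hK : K * Φ = 1) (e : n ⊕ k ≃ m)
    (hΦ : IsUnit (Φ.submatrix (e ∘ Sum.inl) (e ∘ Sum.inl))) {a : n}
    (ha : ∀ q : k, K (e (Sum.inl a)) (e (Sum.inr q)) = 0) (b : n) :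
    (Φ.submatrix (e ∘ Sum.inl) (e ∘ Sum.inl))⁻¹ a b = K (e (Sum.inl a)) (e (Sum.inl b)) := by
  set Ψ := Φ.submatrix (e ∘ Sum.inl) (e ∘ Sum.inl)
  have h1 : (fun b => K (e (Sum.inl a)) (e (Sum.inl b))) ᵥ* Ψ = (1 : Matrix n n ℂ) a := by
    ext c
    have h2 : (K * Φ) (e (Sum.inl a)) (e (Sum.inl c)) = (1 : Matrix n n ℂ) a c := by
      simp [hK, Matrix.one_apply]
    rw [← h2, Matrix.mul_apply, ← e.sum_comp, Fintype.sum_sum_type]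
    simp [ha, Matrix.vecMul, dotProduct, Ψ]
  have h3 : ((fun b => K (e (Sum.inl a)) (e (Sum.inl b))) ᵥ* Ψ) ᵥ* Ψ⁻¹ =
      (1 : Matrix n n ℂ) a ᵥ* Ψ⁻¹ := by rw [h1]
  rw [Matrix.vecMul_vecMul, Matrix.mul_nonsing_inv _ ((Matrix.isUnit_iff_isUnit_det _).1 hΦ),
    Matrix.vecMul_one] at h3
  refine Eq.trans ?_ (congrFun h3 b).symm
  simp [Matrix.vecMul, dotProduct, Matrix.one_apply]

theorem posDef_comp_diagonal {m n : Type*} [Fintype m] [DecidableEq m] [Fintype n] [DecidableEq n]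
    {Q : m → Matrix n n ℂ} (hQ : ∀ i, (Q i).PosDef) :
    (Matrix.compRingEquiv m n ℂ (Matrix.diagonal Q)).PosDef := by
  have hentry : ∀ i s j t, Matrix.compRingEquiv m n ℂ (Matrix.diagonal Q) (i, s) (j, t) =
      if i = j then Q i s t else 0 := by
    intro i s j t
    by_cases h : i = j
    · subst h; simp [Matrix.comp_apply]
    · simp [Matrix.comp_apply, h]
  refine Matrix.PosDef.of_dotProduct_mulVec_pos ?_ fun x hx => ?_
  · ext ⟨i, s⟩ ⟨j, t⟩
    rw [Matrix.conjTranspose_apply, hentry, hentry]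
    by_cases h : i = j
    · subst h; simpa using (hQ i).isHermitian.apply s t
    · simp [h, Ne.symm h]
  · have hsum : star x ⬝ᵥ ((Matrix.compRingEquiv m n ℂ (Matrix.diagonal Q)).mulVec x) =
        ∑ i, star (fun s => x (i, s)) ⬝ᵥ ((Q i).mulVec fun s => x (i, s)) := by
      simp only [dotProduct, Matrix.mulVec, Fintype.sum_prod_type, hentry, Pi.star_apply]
      refine Finset.sum_congr rfl fun i _ => Finset.sum_congr rfl fun s _ => ?_
      congr 1
      rw [Finset.sum_eq_single i (fun j _ hj => by simp [Ne.symm hj]) (by simp)]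
      simp
    rw [hsum]
    obtain ⟨⟨i, s⟩, his⟩ := Function.ne_iff.1 hx
    refine Finset.sum_pos' (fun j _ => (hQ j).posSemidef.dotProduct_mulVec_nonneg _)
      ⟨i, Finset.mem_univ _, (hQ i).dotProduct_mulVec_pos fun h => his (congrFun h s)⟩

/-! ### Discrete Fourier transform of a lifted process -/

/-- The solutions `ζ` of `ζ ^ T = e^{iω}`. -/
def node (T : ℕ) (ω : ℝ) (m : Fin T) : ℂ :=
  Complex.exp (2 * Real.pi * Complex.I / T) ^ (m : ℕ) * Complex.exp (Complex.I * ω / T)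

theorem norm_node (T : ℕ) (ω : ℝ) (m : Fin T) : ‖node T ω m‖ = 1 := by
  have h1 : Complex.I * ω / T = ((ω / T : ℝ) : ℂ) * Complex.I := by push_cast; ring
  have h2 : 2 * Real.pi * Complex.I / T = ((2 * Real.pi / T : ℝ) : ℂ) * Complex.I := by
    push_cast; ring
  rw [node, norm_mul, norm_pow, h1, h2, Complex.norm_exp_ofReal_mul_I,
    Complex.norm_exp_ofReal_mul_I]
  simp

theorem node_ne_zero (T : ℕ) (ω : ℝ) (m : Fin T) : node T ω m ≠ 0 :=
  norm_ne_zero_iff.1 (by rw [norm_node]; exact one_ne_zero)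

theorem exp_div_pow (T : ℕ) [NeZero T] (ω : ℝ) :
    Complex.exp (Complex.I * ω / T) ^ T = Complex.exp (Complex.I * ω) := by
  rw [← Complex.exp_nat_mul]
  congr 1
  field_simp [NeZero.ne T]

theorem node_pow (T : ℕ) [NeZero T] (ω : ℝ) (m : Fin T) :
    node T ω m ^ T = Complex.exp (Complex.I * ω) := by
  rw [node, mul_pow, exp_div_pow, ← pow_mul, mul_comm (m : ℕ), pow_mul,
    (Complex.isPrimitiveRoot_exp T (NeZero.ne T)).pow_eq_one, one_pow, one_mul]

theorem node_injective (T : ℕ) [NeZero T] (ω : ℝ) : Function.Injective (node T ω) := by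
  intro m m' h
  have h1 := mul_right_cancel₀ (Complex.exp_ne_zero _) h
  exact Fin.ext ((Complex.isPrimitiveRoot_exp T (NeZero.ne T)).pow_inj m.2 m'.2 h1)

/-- This is where the excluded frequency matters: `-1` is a `T`-th root of `e^{iω}` exactly when
`e^{iω} = (-1)^T`. -/
theorem node_ne_neg_one {T : ℕ} [NeZero T] {ω : ℝ} (hω : ω ∈ freqs T) (m : Fin T) :
    node T ω m ≠ -1 := fun h => hω.2 (by rw [← node_pow T ω m, h])

/-- Evaluates determinants of lifted filters in closed form; used at `z = 0` and `z = -1`. -/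
theorem X_pow_sub_C_eq_prod_node (T : ℕ) [NeZero T] (ω : ℝ) (z : ℂ) :
    z ^ T - Complex.exp (Complex.I * ω) = ∏ m, (z - node T ω m) := by
  have h := congrArg (Polynomial.eval z) (X_pow_sub_C_eq_prod
    (Complex.isPrimitiveRoot_exp T (NeZero.ne T)) (Nat.pos_of_ne_zero (NeZero.ne T))
    (exp_div_pow T ω))
  simpa [Polynomial.eval_prod, Finset.prod_range, node] using h

/-- The unitary matrix which diagonalizes the lifts of all time invariant filters. -/
def dft (T : ℕ) (ω : ℝ) : Matrix (Fin T) (Fin T) ℂ :=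
  Matrix.of fun m s => ((Real.sqrt T : ℝ) : ℂ)⁻¹ * node T ω m ^ (-((s : ℕ) : ℤ))

theorem star_node (T : ℕ) (ω : ℝ) (m : Fin T) : star (node T ω m) = (node T ω m)⁻¹ := by
  rw [Complex.inv_eq_conj (norm_node T ω m)]; rfl

/-- An off-diagonal entry is a geometric sum whose ratio is a `T`-th root of unity other than one.
-/
theorem dft_mul_conjTranspose (T : ℕ) [NeZero T] (ω : ℝ) : dft T ω * (dft T ω)ᴴ = 1 := by
  have hT : (T : ℂ) ≠ 0 := Nat.cast_ne_zero.2 (NeZero.ne T)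
  have hsq : ((Real.sqrt T : ℝ) : ℂ)⁻¹ * ((Real.sqrt T : ℝ) : ℂ)⁻¹ = (T : ℂ)⁻¹ := by
    rw [← mul_inv, ← Complex.ofReal_mul, Real.mul_self_sqrt (Nat.cast_nonneg T)]; simp
  ext m m'
  have h1 : (dft T ω * (dft T ω)ᴴ) m m' =
      (T : ℂ)⁻¹ * ∑ s ∈ Finset.range T, (node T ω m' / node T ω m) ^ s := by
    rw [Matrix.mul_apply, Finset.sum_range, Finset.mul_sum]
    refine Finset.sum_congr rfl fun s _ => ?_
    rw [Matrix.conjTranspose_apply, dft, Matrix.of_apply, Matrix.of_apply, star_mul', star_zpow₀,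
      star_node, star_inv₀, ← hsq]
    have : star (((Real.sqrt T : ℝ) : ℂ)) = ((Real.sqrt T : ℝ) : ℂ) := Complex.conj_ofReal _
    rw [this, inv_zpow', neg_neg, zpow_neg, zpow_natCast, zpow_natCast, div_pow]
    ring
  rw [h1]
  by_cases h : m = m'
  · subst h
    simp [div_self (node_ne_zero T ω m), hT]
  · have h2 : node T ω m' / node T ω m ≠ 1 := fun h3 => h
      (node_injective T ω ((div_eq_one_iff_eq (node_ne_zero T ω m)).1 h3)).symm
    rw [geom_sum_eq h2, div_pow, node_pow, node_pow, div_self (Complex.exp_ne_zero _)]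
    simp [h]

theorem conjTranspose_mul_dft (T : ℕ) [NeZero T] (ω : ℝ) : (dft T ω)ᴴ * dft T ω = 1 :=
  mul_eq_one_comm.1 (dft_mul_conjTranspose T ω)

/-- The lift of the time invariant filter with frequency response `d m` at `node T ω m`. -/
def lifted (T : ℕ) (ω : ℝ) (d : Fin T → ℂ) : Matrix (Fin T) (Fin T) ℂ :=
  (dft T ω)ᴴ * Matrix.diagonal d * dft T ω

theorem lifted_mul (T : ℕ) [NeZero T] (ω : ℝ) (d d' : Fin T → ℂ) :
    lifted T ω d * lifted T ω d' = lifted T ω (d * d') := by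
  have h : lifted T ω d * lifted T ω d' = (dft T ω)ᴴ * Matrix.diagonal d *
      (dft T ω * (dft T ω)ᴴ) * Matrix.diagonal d' * dft T ω := by
    simp only [lifted, mul_assoc]
  rw [h, dft_mul_conjTranspose, mul_one, lifted, mul_assoc _ (Matrix.diagonal d),
    Matrix.diagonal_mul_diagonal]
  rfl

theorem lifted_one (T : ℕ) [NeZero T] (ω : ℝ) : lifted T ω 1 = 1 := by
  rw [lifted, show Matrix.diagonal (1 : Fin T → ℂ) = 1 from Matrix.diagonal_one, mul_one,
    conjTranspose_mul_dft]

theorem lifted_smul (T : ℕ) (ω : ℝ) (c : ℂ) (d : Fin T → ℂ) :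
    lifted T ω (c • d) = c • lifted T ω d := by
  simp [lifted, Matrix.diagonal_smul]

theorem det_lifted (T : ℕ) [NeZero T] (ω : ℝ) (d : Fin T → ℂ) :
    (lifted T ω d).det = ∏ m, d m := by
  have h : (dft T ω).det * ((dft T ω)ᴴ).det = 1 := by
    rw [← Matrix.det_mul, dft_mul_conjTranspose, Matrix.det_one]
  rw [lifted, Matrix.det_mul, Matrix.det_mul, Matrix.det_diagonal]
  linear_combination (∏ m, d m) * h

/-! ### Cross spectral densities -/

variable {Ω : Type*} [MeasurableSpace Ω] {P : Measure Ω}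

theorem corr_eq_inner (u v : Lp ℂ 2 P) : corr u v = ⟪v, u⟫_ℂ := by
  rw [L2.inner_def]
  rfl

theorem corr_conj (u v : Lp ℂ 2 P) : star (corr u v) = corr v u := by
  rw [corr_eq_inner, corr_eq_inner]; exact inner_conj_symm _ _

theorem corr_sub_left (u u' v : Lp ℂ 2 P) : corr (u - u') v = corr u v - corr u' v := by
  simp only [corr_eq_inner, inner_sub_right]

theorem corr_sum_left {ι : Type*} (s : Finset ι) (u : ι → Lp ℂ 2 P) (v : Lp ℂ 2 P) :
    corr (∑ i ∈ s, u i) v = ∑ i ∈ s, corr (u i) v := by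
  simp only [corr_eq_inner, inner_sum]

/-- `u` and `v` are bounded, their cross correlation is invariant under shifts by `T`, and it is
absolutely summable. -/
structure Coherent (T : ℕ) (u v : ℤ → Lp ℂ 2 P) : Prop where
  bdd_left : ∃ C, ∀ k, ‖u k‖ ≤ C
  bdd_right : ∃ C, ∀ k, ‖v k‖ ≤ C
  periodic : ∀ s t : ℤ, corr (u (s + T)) (v (t + T)) = corr (u s) (v t)
  summable : ∀ t : Fin T, Summable fun j : ℤ => corr (u j) (v (t : ℕ))

/-- The cross spectral density of the lifts of `u` and `v`. -/
def cpsd (T : ℕ) (u v : ℤ → Lp ℂ 2 P) (ω : ℝ) : Matrix (Fin T) (Fin T) ℂ :=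
  Matrix.of fun s t =>
    ∑' k : ℤ, corr (lift T u s k) (lift T v t 0) * Complex.exp (-(Complex.I * ω * k))

theorem lift_zero (T : ℕ) (v : ℤ → Lp ℂ 2 P) (t : Fin T) : lift T v t 0 = v (t : ℕ) := by
  simp [lift]

theorem periodic_mul {T : ℕ} {u v : ℤ → Lp ℂ 2 P}
    (h : ∀ s t : ℤ, corr (u (s + T)) (v (t + T)) = corr (u s) (v t)) (k s t : ℤ) :
    corr (u (k * T + s)) (v (k * T + t)) = corr (u s) (v t) := by
  induction k using Int.induction_on with
  | zero => simp
  | succ n ih => rw [← ih, ← h (n * T + s)]; congr 2 <;> ring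
  | pred n ih => rw [← ih, ← h]; congr 2 <;> ring

/-- Since `‖u k‖² = corr (u k) (u k)` is `T`-periodic, only `T` norms occur. -/
theorem bounded_of_periodic {T : ℕ} [NeZero T] {u : ℤ → Lp ℂ 2 P}
    (h : ∀ s t : ℤ, corr (u (s + T)) (u (t + T)) = corr (u s) (u t)) : ∃ C, ∀ k, ‖u k‖ ≤ C := by
  refine ⟨∑ s : Fin T, ‖u (s : ℕ)‖, fun k => ?_⟩
  obtain ⟨⟨q, r⟩, rfl⟩ := (Int.divModEquiv T).symm.surjective k
  have h1 : ‖u (q * T + (r : ℕ))‖ = ‖u (r : ℕ)‖ := by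
    have h2 := periodic_mul h q (r : ℕ) (r : ℕ)
    rw [corr_eq_inner, corr_eq_inner, inner_self_eq_norm_sq_to_K, inner_self_eq_norm_sq_to_K] at h2
    have h3 : ‖u (q * T + (r : ℕ))‖ ^ 2 = ‖u (r : ℕ)‖ ^ 2 := by exact_mod_cast h2
    exact (pow_left_inj₀ (norm_nonneg _) (norm_nonneg _) two_ne_zero).1 h3
  simp only [Int.divModEquiv_symm_apply]
  rw [h1]
  exact Finset.single_le_sum (f := fun s : Fin T => ‖u (s : ℕ)‖) (fun _ _ => norm_nonneg _)
    (Finset.mem_univ r)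

theorem summable_int_iff_fin {T : ℕ} [NeZero T] {f : ℤ → ℂ} :
    Summable f ↔ ∀ s : Fin T, Summable fun k : ℤ => f (k * T + (s : ℕ)) := by
  rw [← (Int.divModEquiv T).symm.summable_iff, ← (Equiv.prodComm (Fin T) ℤ).summable_iff]
  constructor
  · intro h s
    exact h.prod_factor s
  · intro h
    refine summable_norm_iff.1 ?_
    rw [summable_prod_of_nonneg fun _ => norm_nonneg _]
    exact ⟨fun s => (h s).norm, (hasSum_fintype _).summable⟩

theorem Coherent.of_summable_lift {T : ℕ} [NeZero T] {u v : ℤ → Lp ℂ 2 P}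
    (hu : ∃ C, ∀ k, ‖u k‖ ≤ C) (hv : ∃ C, ∀ k, ‖v k‖ ≤ C)
    (hper : ∀ s t : ℤ, corr (u (s + T)) (v (t + T)) = corr (u s) (v t))
    (h : ∀ s t : Fin T, Summable fun k : ℤ => corr (lift T u s k) (lift T v t 0)) :
    Coherent T u v :=
  ⟨hu, hv, hper, fun t => (summable_int_iff_fin (T := T)).2 fun s => by
    have h1 := h s t
    simp only [lift_zero] at h1
    exact h1⟩

theorem Coherent.summable_lift {T : ℕ} [NeZero T] {u v : ℤ → Lp ℂ 2 P} (h : Coherent T u v)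
    (s t : Fin T) : Summable fun k : ℤ => corr (lift T u s k) (lift T v t 0) := by
  simp only [lift_zero]
  exact (summable_int_iff_fin (T := T)).1 (h.summable t) s

theorem corr_lift_symm {T : ℕ} {u v : ℤ → Lp ℂ 2 P}
    (h : ∀ s t : ℤ, corr (u (s + T)) (v (t + T)) = corr (u s) (v t)) (s t : Fin T) (k : ℤ) :
    corr (lift T v s k) (lift T u t 0) = star (corr (lift T u t (-k)) (lift T v s 0)) := by
  rw [corr_conj]
  have h1 := periodic_mul (u := v) (v := u) (T := T)
    (fun s t => by rw [← corr_conj, h, corr_conj]) (-k) (k * T + (s : ℕ)) (t : ℕ)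
  rw [lift_zero, lift_zero, lift, lift, ← h1]
  congr 2
  ring

theorem Coherent.symm {T : ℕ} [NeZero T] {u v : ℤ → Lp ℂ 2 P} (h : Coherent T u v) :
    Coherent T v u := by
  refine .of_summable_lift h.bdd_right h.bdd_left
    (fun s t => by rw [← corr_conj, h.periodic, corr_conj]) fun s t => ?_
  simp only [corr_lift_symm h.periodic]
  exact ((Equiv.neg ℤ).summable_iff.2 (h.summable_lift t s)).star

theorem Coherent.cpsd_symm {T : ℕ} {u v : ℤ → Lp ℂ 2 P} (h : Coherent T u v)
    (ω : ℝ) : cpsd T v u ω = (cpsd T u v ω)ᴴ := by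
  ext s t
  rw [Matrix.conjTranspose_apply, cpsd, cpsd, Matrix.of_apply, Matrix.of_apply, tsum_star,
    ← (Equiv.neg ℤ).tsum_eq]
  refine tsum_congr fun k => ?_
  rw [corr_lift_symm h.periodic, star_mul', Equiv.neg_apply, neg_neg]
  congr 1
  rw [Complex.star_def, ← Complex.exp_conj]
  simp

theorem norm_node_zpow (T : ℕ) (ω : ℝ) (m : Fin T) (j : ℤ) : ‖node T ω m ^ j‖ = 1 := by
  rw [norm_zpow, norm_node, one_zpow]

theorem summable_mul_node_zpow {T : ℕ} {ω : ℝ} {m : Fin T} {f : ℤ → ℂ} (hf : Summable f) :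
    Summable fun j : ℤ => f j * node T ω m ^ (-j) :=
  summable_norm_iff.1 (by simpa only [norm_mul, norm_node_zpow, mul_one] using hf.norm)

/-- The transform undoes the lift. As `node ^ T = e^{iω}`, the phase `e^{-iωk}` equals `node ^
(-kT)`, and the sums over block `k` and offset `s` merge into one series over `j = kT + s`. -/
theorem Coherent.dft_mul_cpsd {T : ℕ} [NeZero T] {u v : ℤ → Lp ℂ 2 P} (h : Coherent T u v)
    (ω : ℝ) (m t : Fin T) :
    (dft T ω * cpsd T u v ω) m t = ((Real.sqrt T : ℝ) : ℂ)⁻¹ *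
      ∑' j : ℤ, corr (u j) (v (t : ℕ)) * node T ω m ^ (-j) := by
  have hs := summable_mul_node_zpow (ω := ω) (m := m) (h.summable t)
  rw [← (Int.divModEquiv T).symm.tsum_eq, ← (Equiv.prodComm (Fin T) ℤ).tsum_eq,
    Summable.tsum_prod, tsum_fintype, Matrix.mul_apply, Finset.mul_sum]
  · refine Finset.sum_congr rfl fun s _ => ?_
    rw [dft, cpsd, Matrix.of_apply, Matrix.of_apply, mul_assoc, ← tsum_mul_left]
    congr 1
    refine tsum_congr fun k => ?_
    have h1 : node T ω m ^ (-(k * (T : ℤ) + (s : ℕ))) =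
        node T ω m ^ (-((s : ℕ) : ℤ)) * Complex.exp (-(Complex.I * ω * k)) := by
      rw [neg_add, zpow_add₀ (node_ne_zero T ω m), mul_comm k, neg_mul_eq_mul_neg, zpow_mul,
        zpow_natCast, node_pow, ← Complex.exp_int_mul, mul_comm]
      congr 2
      push_cast
      ring
    simp only [Equiv.prodComm_apply, Prod.swap_prod_mk, Int.divModEquiv_symm_apply, lift_zero, h1]
    rw [lift]
    ring
  · exact (Equiv.prodComm (Fin T) ℤ).summable_iff.2 ((Int.divModEquiv T).symm.summable_iff.2 hs)

/-! ### Filters -/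

theorem summable_conv {c : ℤ → ℂ} (hc : Summable c) {u : ℤ → Lp ℂ 2 P}
    (hu : ∃ C, ∀ k, ‖u k‖ ≤ C) (k : ℤ) : Summable fun n : ℤ => c n • u (k - n) := by
  obtain ⟨C, hC⟩ := hu
  refine Summable.of_norm_bounded (hc.norm.mul_right C) fun n => ?_
  rw [norm_smul]
  exact mul_le_mul_of_nonneg_left (hC _) (norm_nonneg _)

theorem hasSum_corr_conv {c : ℤ → ℂ} (hc : Summable c) {u : ℤ → Lp ℂ 2 P}
    (hu : ∃ C, ∀ k, ‖u k‖ ≤ C) (k : ℤ) (v : Lp ℂ 2 P) :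
    HasSum (fun n : ℤ => c n * corr (u (k - n)) v) (corr (conv c u k) v) := by
  have h := (summable_conv hc hu k).hasSum.mapL (innerSL ℂ v)
  simpa [corr_eq_inner, conv, inner_smul_right] using h

theorem bounded_conv {c : ℤ → ℂ} (hc : Summable c) {u : ℤ → Lp ℂ 2 P}
    (hu : ∃ C, ∀ k, ‖u k‖ ≤ C) : ∃ C, ∀ k, ‖conv c u k‖ ≤ C := by
  obtain ⟨C, hC⟩ := hu
  refine ⟨∑' n, ‖c n‖ * C, fun k => ?_⟩
  have h1 : ∀ n, ‖c n • u (k - n)‖ ≤ ‖c n‖ * C := fun n => by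
    rw [norm_smul]
    exact mul_le_mul_of_nonneg_left (hC _) (norm_nonneg _)
  exact tsum_of_norm_bounded (hc.norm.mul_right C).hasSum h1

/-- Reindexing `(n, i) ↦ (n, i + n)`. -/
def shearEquiv : ℤ × ℤ ≃ ℤ × ℤ where
  toFun q := (q.1, q.2 + q.1)
  invFun q := (q.1, q.2 - q.1)
  left_inv q := by simp
  right_inv q := by simp

/-- Cauchy product over `ℤ`. The inner sums are a hypothesis, so that `g` can be the correlation of
a filtered process, with or without powers of a node. -/
theorem hasSum_cauchy {c f : ℤ → ℂ} (hc : Summable c) (hf : Summable f) {g : ℤ → ℂ}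
    (hg : ∀ j, HasSum (fun n => c n * f (j - n)) (g j)) :
    Summable g ∧ HasSum g ((∑' n, c n) * ∑' j, f j) := by
  have h1 : Summable fun q : ℤ × ℤ => c q.1 * f q.2 :=
    summable_mul_of_summable_norm hc.norm hf.norm
  have h2 : HasSum (fun q : ℤ × ℤ => c q.1 * f q.2) ((∑' n, c n) * ∑' j, f j) := by
    rw [tsum_mul_tsum_of_summable_norm hc.norm hf.norm]
    exact h1.hasSum
  have h3 : HasSum (fun q : ℤ × ℤ => c q.2 * f (q.1 - q.2)) ((∑' n, c n) * ∑' j, f j) := by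
    rw [← (shearEquiv.trans (Equiv.prodComm ℤ ℤ)).hasSum_iff]
    simpa [Function.comp_def, shearEquiv] using h2
  exact ⟨(h3.prod_fiberwise hg).summable, h3.prod_fiberwise hg⟩

theorem Coherent.conv_left {T : ℕ} [NeZero T] {u v : ℤ → Lp ℂ 2 P} (h : Coherent T u v)
    {c : ℤ → ℂ} (hc : Summable c) : Coherent T (conv c u) v := by
  refine ⟨bounded_conv hc h.bdd_left, h.bdd_right, fun s t => ?_, fun t => ?_⟩
  · refine (hasSum_corr_conv hc h.bdd_left _ _).unique ?_
    convert hasSum_corr_conv hc h.bdd_left s (v t) using 3 with n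
    rw [← h.periodic (s - n)]
    congr 2
    ring
  · exact (hasSum_cauchy hc (h.summable t) fun j => hasSum_corr_conv hc h.bdd_left j _).1

/-- After the transform each row is a series at one node, where convolution becomes multiplication
by the frequency response. -/
theorem Coherent.cpsd_conv_left {T : ℕ} [NeZero T] {u v : ℤ → Lp ℂ 2 P} (h : Coherent T u v)
    {c : ℤ → ℂ} (hc : Summable c) (ω : ℝ) {d : Fin T → ℂ}
    (hd : ∀ m, HasSum (fun n : ℤ => c n * node T ω m ^ (-n)) (d m)) :
    cpsd T (conv c u) v ω = lifted T ω d * cpsd T u v ω := by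
  have h1 : dft T ω * cpsd T (conv c u) v ω = Matrix.diagonal d * (dft T ω * cpsd T u v ω) := by
    ext m t
    rw [(h.conv_left hc).dft_mul_cpsd, Matrix.diagonal_mul, h.dft_mul_cpsd, mul_left_comm,
      ← (hd m).tsum_eq]
    congr 1
    refine (hasSum_cauchy (hd m).summable
      (summable_mul_node_zpow (h.summable t)) fun j => ?_).2.tsum_eq
    refine ((hasSum_corr_conv hc h.bdd_left j (v (t : ℕ))).mul_right
      (node T ω m ^ (-j))).congr_fun fun n => ?_
    rw [show -j = -n + -(j - n) by ring, zpow_add₀ (node_ne_zero T ω m)]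
    ring
  rw [lifted, mul_assoc, mul_assoc, ← h1, ← mul_assoc, conjTranspose_mul_dft, one_mul]

theorem Coherent.cpsd_conv_right {T : ℕ} [NeZero T] {u v : ℤ → Lp ℂ 2 P} (h : Coherent T u v)
    {c : ℤ → ℂ} (hc : Summable c) (ω : ℝ) {d : Fin T → ℂ}
    (hd : ∀ m, HasSum (fun n : ℤ => c n * node T ω m ^ (-n)) (d m)) :
    cpsd T u (conv c v) ω = cpsd T u v ω * (lifted T ω d)ᴴ := by
  rw [(h.symm.conv_left hc).cpsd_symm, h.symm.cpsd_conv_left hc ω hd, h.cpsd_symm,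
    Matrix.conjTranspose_mul, Matrix.conjTranspose_conjTranspose]

theorem Coherent.sub_sum_left {T : ℕ} {ι : Type*} {s : Finset ι} {u v : ℤ → Lp ℂ 2 P}
    {w : ι → ℤ → Lp ℂ 2 P} (hu : Coherent T u v) (hw : ∀ i, Coherent T (w i) v) :
    Coherent T (fun k => u k - ∑ i ∈ s, w i k) v := by
  refine ⟨?_, hu.bdd_right, fun a b => ?_, fun t => ?_⟩
  · obtain ⟨C, hC⟩ := hu.bdd_left
    choose D hD using fun i => (hw i).bdd_left
    exact ⟨C + ∑ i ∈ s, D i, fun k => (norm_sub_le _ _).trans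
      (add_le_add (hC k) (norm_sum_le_of_le _ fun i _ => hD i k))⟩
  · simp only [corr_sub_left, corr_sum_left, hu.periodic, (hw _).periodic]
  · simp only [corr_sub_left, corr_sum_left]
    exact (hu.summable t).sub (summable_sum fun i _ => (hw i).summable t)

theorem Coherent.cpsd_sub_sum_left {T : ℕ} [NeZero T] {ι : Type*} {s : Finset ι}
    {u v : ℤ → Lp ℂ 2 P} {w : ι → ℤ → Lp ℂ 2 P} (hu : Coherent T u v)
    (hw : ∀ i, Coherent T (w i) v) (ω : ℝ) :
    cpsd T (fun k => u k - ∑ i ∈ s, w i k) v ω = cpsd T u v ω - ∑ i ∈ s, cpsd T (w i) v ω := by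
  have hexp : ∀ k : ℤ, ‖Complex.exp (-(Complex.I * ω * k))‖ = 1 := fun k => by
    rw [show -(Complex.I * ω * k) = ((-(ω * k) : ℝ) : ℂ) * Complex.I by push_cast; ring,
      Complex.norm_exp_ofReal_mul_I]
  have hsum : ∀ {w : ℤ → Lp ℂ 2 P}, Coherent T w v → ∀ a t : Fin T, Summable fun k : ℤ =>
      corr (lift T w a k) (lift T v t 0) * Complex.exp (-(Complex.I * ω * k)) := fun h a t =>
    summable_norm_iff.1 (by simpa [norm_mul, hexp] using (h.summable_lift a t).norm)
  ext a t
  rw [Matrix.sub_apply, Matrix.sum_apply]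
  simp only [cpsd, Matrix.of_apply]
  rw [← Summable.tsum_finsetSum fun i _ => hsum (hw i) a t,
    ← (hsum hu a t).tsum_sub (summable_sum fun i _ => hsum (hw i) a t)]
  refine tsum_congr fun k => ?_
  rw [show lift T (fun k => u k - ∑ i ∈ s, w i k) a k = lift T u a k - ∑ i ∈ s, lift T (w i) a k
    from rfl, corr_sub_left, corr_sum_left, sub_mul, Finset.sum_mul]

/-! ### Filters with absolutely summable impulse response -/

/-- On the unit circle without `-1`, `f` is the z-transform of an absolutely summable sequence. -/
def IsWiener (f : ℂ → ℂ) : Prop :=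
  ∃ c : ℤ → ℂ, Summable c ∧
    ∀ z : ℂ, ‖z‖ = 1 → z ≠ -1 → HasSum (fun n : ℤ => c n * z ^ (-n)) (f z)

theorem IsWiener.congr {f g : ℂ → ℂ} (hf : IsWiener f)
    (h : ∀ z : ℂ, ‖z‖ = 1 → z ≠ -1 → f z = g z) : IsWiener g := by
  obtain ⟨c, hc, hcf⟩ := hf
  exact ⟨c, hc, fun z hz hz1 => h z hz hz1 ▸ hcf z hz hz1⟩

theorem isWiener_const_mul_zpow (a : ℂ) (k : ℤ) : IsWiener fun z => a * z ^ k := by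
  refine ⟨Pi.single (-k) a, (hasSum_pi_single _ _).summable, fun z _ _ => ?_⟩
  have h := hasSum_single (f := fun n : ℤ => (Pi.single (-k) a : ℤ → ℂ) n * z ^ (-n)) (-k)
    (fun n hn => by simp [Pi.single_eq_of_ne hn])
  simpa using h

theorem IsWiener.add {f g : ℂ → ℂ} (hf : IsWiener f) (hg : IsWiener g) :
    IsWiener fun z => f z + g z := by
  obtain ⟨c, hc, hcf⟩ := hf
  obtain ⟨d, hd, hdg⟩ := hg
  refine ⟨fun n => c n + d n, hc.add hd, fun z hz hz1 => ?_⟩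
  simpa only [add_mul] using (hcf z hz hz1).add (hdg z hz hz1)

theorem IsWiener.mul {f g : ℂ → ℂ} (hf : IsWiener f) (hg : IsWiener g) :
    IsWiener fun z => f z * g z := by
  obtain ⟨c, hc, hcf⟩ := hf
  obtain ⟨d, hd, hdg⟩ := hg
  have hs : ∀ j : ℤ, Summable fun n => c n * d (j - n) := fun j => by
    have h1 : Summable fun q : ℤ × ℤ => c q.1 * d q.2 :=
      summable_mul_of_summable_norm hc.norm hd.norm
    exact h1.comp_injective (i := fun n : ℤ => (n, j - n)) fun n m h => (Prod.ext_iff.1 h).1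
  refine ⟨fun j => ∑' n, c n * d (j - n), (hasSum_cauchy hc hd fun j => (hs j).hasSum).1,
    fun z hz hz1 => ?_⟩
  have hz0 : z ≠ 0 := norm_ne_zero_iff.1 (by rw [hz]; exact one_ne_zero)
  change HasSum _ (f z * g z)
  rw [← (hcf z hz hz1).tsum_eq, ← (hdg z hz hz1).tsum_eq]
  refine (hasSum_cauchy (hcf z hz hz1).summable (hdg z hz hz1).summable fun j => ?_).2
  refine ((hs j).hasSum.mul_right (z ^ (-j))).congr_fun fun n => ?_
  rw [show -j = -n + -(j - n) by ring, zpow_add₀ hz0]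
  ring

theorem isWiener_one_sub_inv {a : ℂ} {k : ℤ} (ha : ‖a‖ < 1) (hk : k ≠ 0) :
    IsWiener fun z => (1 - a * z ^ (-k))⁻¹ := by
  classical
  have hinj : Function.Injective fun m : ℕ => k * (m : ℤ) := fun m m' h => by
    exact_mod_cast mul_left_cancel₀ hk h
  -- Geometric coefficients sit at the multiples `k * m` and zeros elsewhere; `k = 1` expands in
  -- `z⁻¹` and `k = -1` in `z`.
  refine ⟨Function.extend (fun m : ℕ => k * (m : ℤ)) (fun m => a ^ m) 0, ?_, fun z hz _ => ?_⟩
  · rw [← hinj.summable_iff fun n hn => (Function.extend_apply' _ _ n hn).trans rfl]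
    simpa [Function.comp_def, hinj.extend_apply] using summable_geometric_of_norm_lt_one ha
  · have h1 : ‖a * z ^ (-k)‖ < 1 := by simpa [norm_zpow, hz] using ha
    rw [← hinj.hasSum_iff fun n hn => by
      rw [Function.extend_apply' _ _ _ hn]; simp]
    refine (hasSum_geometric_of_norm_lt_one h1).congr_fun fun m => ?_
    simp only [Function.comp_apply, hinj.extend_apply, mul_pow]
    rw [← neg_mul, zpow_mul, zpow_natCast]

/-- A linear fractional function without poles on the unit circle. -/
theorem isWiener_inv_linear {p q : ℂ} (h : ‖p‖ ≠ ‖q‖) : IsWiener fun z => (p * z - q)⁻¹ := by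
  -- Factor out the dominant term: a pole outside the circle (or none) gives a series in `z`, a pole
  -- inside one in `z⁻¹`.
  rcases lt_or_gt_of_ne h with h | h
  · have hq : q ≠ 0 := norm_pos_iff.1 ((norm_nonneg p).trans_lt h)
    have h1 : ‖p / q‖ < 1 := by rw [norm_div, div_lt_one (norm_pos_iff.2 hq)]; exact h
    refine ((isWiener_const_mul_zpow (-q⁻¹) 0).mul
      (isWiener_one_sub_inv (k := -1) h1 (by norm_num))).congr fun z _ _ => ?_
    rw [neg_neg, zpow_zero, zpow_one, mul_one, neg_mul, ← mul_inv, ← inv_neg]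
    congr 1
    field_simp
    ring
  · have hp : p ≠ 0 := norm_pos_iff.1 ((norm_nonneg q).trans_lt h)
    have h1 : ‖q / p‖ < 1 := by rw [norm_div, div_lt_one (norm_pos_iff.2 hp)]; exact h
    refine ((isWiener_const_mul_zpow p⁻¹ (-1)).mul
      (isWiener_one_sub_inv (k := 1) h1 one_ne_zero)).congr fun z hz _ => ?_
    have hz0 : z ≠ 0 := norm_ne_zero_iff.1 (by rw [hz]; exact one_ne_zero)
    rw [zpow_neg_one, ← mul_inv, ← mul_inv]
    congr 1
    field_simp

/-- The bilinear transform of the derivative. -/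
def tustin (Δt : ℝ) (z : ℂ) : ℂ := 2 * (1 - z⁻¹) / (Δt * (1 + z⁻¹))

theorem tustin_eq {Δt : ℝ} {z : ℂ} (hz : ‖z‖ = 1) : tustin Δt z = 2 * (z - 1) / (Δt * (z + 1)) := by
  have hz0 : z ≠ 0 := norm_ne_zero_iff.1 (by rw [hz]; exact one_ne_zero)
  rw [tustin, ← mul_div_mul_right _ _ hz0]
  congr 1 <;> field_simp

/-- Clearing denominators gives `Δt (z + 1) / ((2 - ρΔt) z - (2 + ρΔt))`, so the singular point `-1`
is not a pole of the reciprocal. -/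
theorem isWiener_inv_tustin_sub {Δt : ℝ} (hΔt : 0 < Δt) {ρ : ℂ}
    (h : ∀ z : ℂ, ‖z‖ = 1 → z ≠ -1 → tustin Δt z - ρ ≠ 0) :
    IsWiener fun z => (tustin Δt z - ρ)⁻¹ := by
  have hΔ : (Δt : ℂ) ≠ 0 := Complex.ofReal_ne_zero.2 hΔt.ne'
  -- Equal moduli would place a zero of `tustin Δt - ρ` on the circle away from `-1`.
  have hpq : ‖2 - ρ * Δt‖ ≠ ‖2 + ρ * Δt‖ := by
    intro he
    have hp : 2 - ρ * Δt ≠ 0 := by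
      intro hp
      have hq : 2 + ρ * Δt = 0 := norm_eq_zero.1 (by rw [← he, hp, norm_zero])
      exact four_ne_zero (by linear_combination hp + hq : (4 : ℂ) = 0)
    have hz1 : (2 + ρ * Δt) / (2 - ρ * Δt) ≠ -1 := by
      intro h1
      rw [div_eq_iff hp] at h1
      exact four_ne_zero (by linear_combination h1 : (4 : ℂ) = 0)
    have hz : ‖(2 + ρ * Δt) / (2 - ρ * Δt)‖ = 1 := by
      rw [norm_div, he, div_self]
      rw [← he]; exact norm_ne_zero_iff.2 hp
    refine h _ hz hz1 ?_
    have hz2 : (2 + ρ * Δt) / (2 - ρ * Δt) + 1 ≠ 0 := fun h2 => hz1 (eq_neg_of_add_eq_zero_left h2)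
    rw [tustin_eq hz, sub_eq_zero, div_eq_iff (mul_ne_zero hΔ hz2)]
    field_simp
    ring
  refine ((((isWiener_const_mul_zpow Δt 1).add (isWiener_const_mul_zpow Δt 0))).mul
    (isWiener_inv_linear hpq)).congr fun z hz hz1 => ?_
  have hz2 : z + 1 ≠ 0 := fun h2 => hz1 (eq_neg_of_add_eq_zero_left h2)
  have h3 : tustin Δt z - ρ = ((2 - ρ * Δt) * z - (2 + ρ * Δt)) / (Δt * (z + 1)) := by
    rw [tustin_eq hz, eq_div_iff (mul_ne_zero hΔ hz2), sub_mul, div_mul_cancel₀ _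
      (mul_ne_zero hΔ hz2)]
    ring
  rw [h3, inv_div, div_eq_mul_inv, zpow_one, zpow_zero]
  ring

/-- Over `ℂ` the polynomial splits, and reciprocals of linear factors multiply within the algebra of
absolutely summable filters. -/
theorem isWiener_inv_eval_tustin {Δt : ℝ} (hΔt : 0 < Δt) (p : Polynomial ℂ)
    (h : ∀ z : ℂ, ‖z‖ = 1 → z ≠ -1 → p.eval (tustin Δt z) ≠ 0) :
    IsWiener fun z => (p.eval (tustin Δt z))⁻¹ := by
  have hp := (IsAlgClosed.splits p).eq_prod_roots
  have hev : ∀ w : ℂ, p.eval w = p.leadingCoeff * (p.roots.map fun ρ => w - ρ).prod := by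
    intro w
    conv_lhs => rw [hp]
    rw [Polynomial.eval_mul, Polynomial.eval_C, Polynomial.eval_multiset_prod, Multiset.map_map]
    simp
  simp only [hev] at h ⊢
  generalize p.leadingCoeff = a at h
  generalize p.roots = s at h
  clear hp hev
  induction s using Multiset.induction_on with
  | empty => simpa using isWiener_const_mul_zpow a⁻¹ 0
  | cons ρ s ih =>
    simp only [Multiset.map_cons, Multiset.prod_cons] at h ⊢
    refine ((isWiener_inv_tustin_sub (ρ := ρ) hΔt fun z hz hz1 h0 => h z hz hz1 (by rw [h0]; simp)).mul
      (ih fun z hz hz1 h0 => h z hz hz1 (by rw [mul_left_comm, h0, mul_zero]))).congr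
      fun z _ _ => ?_
    rw [← mul_inv, mul_left_comm]

/-! ### Inversion of the z-transform -/

theorem integral_exp_int_mul (j : ℤ) :
    ∫ ω in (0 : ℝ)..(2 * Real.pi), Complex.exp (Complex.I * j * ω) =
      if j = 0 then (2 * Real.pi : ℂ) else 0 := by
  split_ifs with h
  · subst h; simp
  · have h1 : Complex.I * j ≠ 0 := mul_ne_zero Complex.I_ne_zero (Int.cast_ne_zero.2 h)
    rw [integral_exp_mul_complex h1]
    have h2 : Complex.I * j * ((2 * Real.pi : ℝ) : ℂ) = j * (2 * Real.pi * Complex.I) := by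
      push_cast; ring
    rw [h2, Complex.exp_int_mul_two_pi_mul_I]
    simp

/-- Absolute summability permits termwise integration. The point `-1` corresponds to the null set `ω
= π`, so the value of `f` there is irrelevant. -/
theorem invZ_eq {f : ℂ → ℂ} {c : ℤ → ℂ} (hc : Summable c)
    (hf : ∀ z : ℂ, ‖z‖ = 1 → z ≠ -1 → HasSum (fun n : ℤ => c n * z ^ (-n)) (f z)) :
    invZ f = c := by
  have hnorm : ∀ x : ℝ, ‖Complex.exp (Complex.I * x)‖ = 1 := fun x => by
    rw [mul_comm, Complex.norm_exp_ofReal_mul_I]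
  have hnorm' : ∀ (j : ℤ) (x : ℝ), ‖Complex.exp (Complex.I * j * x)‖ = 1 := fun j x => by
    rw [show Complex.I * j * x = Complex.I * ((j * x : ℝ) : ℂ) by push_cast; ring, hnorm]
  funext n
  have h := intervalIntegral.hasSum_integral_of_dominated_convergence (μ := volume) (a := 0)
    (b := 2 * Real.pi)
    (F := fun (k : ℤ) (x : ℝ) => c k * Complex.exp (Complex.I * ((n - k : ℤ) : ℂ) * x))
    (f := fun x : ℝ => f (Complex.exp (Complex.I * x)) * Complex.exp (Complex.I * n * x))
    (fun k _ => ‖c k‖)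
    (fun k => (Continuous.aestronglyMeasurable (by fun_prop)))
    (fun k => ae_of_all _ fun x _ => by rw [norm_mul, hnorm', mul_one])
    (ae_of_all _ fun x _ => hc.norm)
    intervalIntegrable_const ?_
  · simp only [intervalIntegral.integral_const_mul, integral_exp_int_mul] at h
    have h2 := hasSum_single (f := fun k : ℤ => c k * if n - k = 0 then (2 * Real.pi : ℂ) else 0) n
      (fun k hk => by rw [if_neg (sub_ne_zero.2 hk.symm), mul_zero])
    have h3 := h.unique h2
    rw [invZ, h3, sub_self, if_pos rfl, mul_comm (c n), inv_mul_cancel_left₀]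
    exact_mod_cast Real.two_pi_pos.ne'
  · filter_upwards [Measure.ae_ne volume Real.pi] with x hx hx2
    rw [uIoc_of_le Real.two_pi_pos.le] at hx2
    have hne : Complex.exp (Complex.I * x) ≠ -1 := by
      intro h1
      rw [← Complex.exp_pi_mul_I, Complex.exp_eq_exp_iff_exists_int] at h1
      obtain ⟨k, hk⟩ := h1
      have h2 : x = Real.pi + k * (2 * Real.pi) := by
        have h3 : (x : ℂ) = Real.pi + k * (2 * Real.pi) :=
          mul_left_cancel₀ Complex.I_ne_zero (by rw [hk]; ring)
        exact_mod_cast h3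
      have hk0 : k = 0 := by
        have h4 : (k : ℝ) < 1 := by nlinarith [hx2.2, Real.pi_pos]
        have h5 : (-1 : ℝ) < k := by nlinarith [hx2.1, Real.pi_pos]
        have h6 : k < 1 := by exact_mod_cast h4
        have h7 : -1 < k := by exact_mod_cast h5
        omega
      exact hx (by rw [h2, hk0]; simp)
    refine ((hf _ (hnorm x) hne).mul_right (Complex.exp (Complex.I * n * x))).congr_fun fun k => ?_
    rw [← Complex.exp_int_mul, mul_assoc (c k), ← Complex.exp_add]
    congr 2
    push_cast
    ring

section Model

variable {V : Type*} {G : SimpleGraph V} {l : ℕ}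

theorem sysS_eq_eval (Δt : ℝ) (θ : Params G l) (i : V) (z : ℂ) :
    sysS Δt θ i z = (∑ n : Fin (l + 1),
      Polynomial.monomial (n : ℕ) (θ.1 i n)).eval (tustin Δt z) := by
  simp [sysS, tustin, Polynomial.eval_finsetSum]

theorem invZ_inv_sysS {Δt : ℝ} (hΔt : 0 < Δt) {θ : Params G l} (h : Stable Δt θ) (i : V) :
    Summable (invZ fun z => (sysS Δt θ i z)⁻¹) ∧
    ∀ z : ℂ, ‖z‖ = 1 → z ≠ -1 →
      HasSum (fun n : ℤ => invZ (fun z => (sysS Δt θ i z)⁻¹) n * z ^ (-n)) (sysS Δt θ i z)⁻¹ := by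
  have h1 : IsWiener fun z => (sysS Δt θ i z)⁻¹ := by
    simp only [sysS_eq_eval]
    refine isWiener_inv_eval_tustin hΔt _ fun z hz hz1 => ?_
    rw [← sysS_eq_eval]
    exact h i z hz hz1
  obtain ⟨c, hc, hcf⟩ := h1
  rw [invZ_eq hc hcf]
  exact ⟨hc, hcf⟩

theorem invZ_transfer {Δt : ℝ} (hΔt : 0 < Δt) {θ : Params G l} (h : Stable Δt θ) (i j : V) :
    Summable (invZ (transfer Δt θ i j)) ∧
    ∀ z : ℂ, ‖z‖ = 1 → z ≠ -1 →
      HasSum (fun n : ℤ => invZ (transfer Δt θ i j) n * z ^ (-n))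
        (weight θ i j * (sysS Δt θ i z)⁻¹) := by
  obtain ⟨h1, h2⟩ := invZ_inv_sysS hΔt h i
  have h3 : ∀ z : ℂ, ‖z‖ = 1 → z ≠ -1 →
      HasSum (fun n : ℤ => (weight θ i j * invZ (fun z => (sysS Δt θ i z)⁻¹) n) * z ^ (-n))
        (weight θ i j * (sysS Δt θ i z)⁻¹) := fun z hz hz1 => by
    simpa only [mul_assoc] using (h2 z hz hz1).mul_left (weight θ i j)
  have h4 : invZ (transfer Δt θ i j) =
      fun n => weight θ i j * invZ (fun z => (sysS Δt θ i z)⁻¹) n :=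
    invZ_eq (h1.mul_left _) h3
  rw [h4]
  exact ⟨h1.mul_left _, h3⟩

end Model

/-! ### The inverse spectral density of a linear dynamical model -/

section Model

set_option linter.unusedSectionVars false

variable {V : Type*} {G : SimpleGraph V} {l : ℕ}

theorem weight_self (θ : Params G l) (i : V) : weight θ i i = 0 := by
  simp [weight]

/-- The lift of `S_i`. -/
def liftS (T : ℕ) (Δt : ℝ) (θ : Params G l) (ω : ℝ) (i : V) : Matrix (Fin T) (Fin T) ℂ :=
  lifted T ω fun m => sysS Δt θ i (node T ω m)

/-- The lift of `1 / S_i`. -/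
def liftInvS (T : ℕ) (Δt : ℝ) (θ : Params G l) (ω : ℝ) (i : V) : Matrix (Fin T) (Fin T) ℂ :=
  lifted T ω fun m => (sysS Δt θ i (node T ω m))⁻¹

theorem liftInvS_mul_liftS {T : ℕ} [NeZero T] {Δt : ℝ} {θ : Params G l} (h : Stable Δt θ) {ω : ℝ}
    (hω : ω ∈ freqs T) (i : V) : liftInvS T Δt θ ω i * liftS T Δt θ ω i = 1 := by
  rw [liftInvS, liftS, lifted_mul, ← lifted_one T ω]
  congr 1
  funext m
  exact inv_mul_cancel₀ (h i _ (norm_node T ω m) (node_ne_neg_one hω m))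

theorem liftS_mul_liftInvS {T : ℕ} [NeZero T] {Δt : ℝ} {θ : Params G l} (h : Stable Δt θ) {ω : ℝ}
    (hω : ω ∈ freqs T) (i : V) : liftS T Δt θ ω i * liftInvS T Δt θ ω i = 1 :=
  mul_eq_one_comm.1 (liftInvS_mul_liftS h hω i)

variable [DecidableEq V]

/-- The lift of the operator `x_i ↦ S_i x_i - ∑ⱼ b_{ij} x_j` which maps the states to the physical
inputs. -/
def stateToInput (T : ℕ) (Δt : ℝ) (θ : Params G l) (ω : ℝ) :
    Matrix V V (Matrix (Fin T) (Fin T) ℂ) :=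
  Matrix.diagonal (liftS T Δt θ ω) - Matrix.of fun i j => weight θ i j • 1

variable {Ω : Type*} [MeasurableSpace Ω] {P : Measure Ω}

/-- The block matrix of the cross spectral densities of a family of processes. -/
def blockPsd (T : ℕ) (x : V → ℤ → Lp ℂ 2 P) (ω : ℝ) : Matrix V V (Matrix (Fin T) (Fin T) ℂ) :=
  Matrix.of fun i j => cpsd T (x i) (x j) ω

/-- The block matrix `(S - B)* Φ_P⁻¹ (S - B)`. -/
def precision [Fintype V] (T : ℕ) (Δt : ℝ) (θ : Params G l) (p : V → ℤ → Lp ℂ 2 P) (ω : ℝ) :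
    Matrix V V (Matrix (Fin T) (Fin T) ℂ) :=
  (stateToInput T Δt θ ω)ᴴ * Matrix.diagonal (fun i => (cpsd T (p i) (p i) ω)⁻¹) *
    stateToInput T Δt θ ω

theorem precision_apply [Fintype V] (T : ℕ) (Δt : ℝ) (θ : Params G l) (p : V → ℤ → Lp ℂ 2 P)
    (ω : ℝ) (i j : V) :
    precision T Δt θ p ω i j = ∑ k, (stateToInput T Δt θ ω k i)ᴴ * (cpsd T (p k) (p k) ω)⁻¹ *
      stateToInput T Δt θ ω k j := by
  rw [precision, Matrix.mul_apply]
  refine Finset.sum_congr rfl fun k _ => ?_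
  rw [Matrix.mul_diagonal]
  rfl

variable [Fintype V] {Δt : ℝ} {T : ℕ} {θ : Params G l} {p x : V → ℤ → Lp ℂ 2 P}

theorem IsLDM.coherent [NeZero T] (h : IsLDM Δt T θ p x) (i j : V) : Coherent T (x i) (x j) :=
  .of_summable_lift (bounded_of_periodic (h.jwscs.2 (.inl i) (.inl i)))
    (bounded_of_periodic (h.jwscs.2 (.inl j) (.inl j))) (h.jwscs.2 (.inl i) (.inl j))
    fun s t => h.hasPSD (i, s) (j, t)

theorem IsLDM.input_eq (h : IsLDM Δt T θ p x) (i : V) :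
    input Δt θ p i = fun k => x i k -
      ∑ j ∈ Finset.univ.erase i, conv (invZ (transfer Δt θ i j)) (x j) k := by
  funext k
  rw [h.dynamics i k]
  abel

/-- The lift of the operator `x_i ↦ x_i - ∑ⱼ h_{ij} x_j`. -/
def stateToNoise (T : ℕ) (Δt : ℝ) (θ : Params G l) (ω : ℝ) :
    Matrix V V (Matrix (Fin T) (Fin T) ℂ) :=
  Matrix.diagonal (liftInvS T Δt θ ω) * stateToInput T Δt θ ω

theorem stateToNoise_apply [NeZero T] (h : Stable Δt θ) {ω : ℝ} (hω : ω ∈ freqs T) (i j : V) :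
    stateToNoise T Δt θ ω i j =
      (if i = j then 1 else 0) - weight θ i j • liftInvS T Δt θ ω i := by
  rw [stateToNoise, Matrix.diagonal_mul, stateToInput, Matrix.sub_apply, mul_sub,
    Matrix.of_apply, mul_smul_comm, mul_one]
  by_cases hij : i = j
  · subst hij
    rw [Matrix.diagonal_apply_eq, liftInvS_mul_liftS h hω, if_pos rfl]
  · rw [Matrix.diagonal_apply_ne _ hij, mul_zero, if_neg hij]

theorem IsLDM.coherent_input_left [NeZero T] (hΔt : 0 < Δt) (h : IsLDM Δt T θ p x)
    {v : ℤ → Lp ℂ 2 P} (hv : ∀ j, Coherent T (x j) v) (i : V) :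
    Coherent T (input Δt θ p i) v := by
  rw [h.input_eq i]
  exact (hv i).sub_sum_left fun j => (hv j).conv_left (invZ_transfer hΔt h.stable i j).1

theorem IsLDM.cpsd_input_left [NeZero T] (hΔt : 0 < Δt) (h : IsLDM Δt T θ p x)
    {v : ℤ → Lp ℂ 2 P} (hv : ∀ j, Coherent T (x j) v) {ω : ℝ} (hω : ω ∈ freqs T) (i : V) :
    cpsd T (input Δt θ p i) v ω = ∑ j, stateToNoise T Δt θ ω i j * cpsd T (x j) v ω := by
  have h1 : ∀ j, cpsd T (conv (invZ (transfer Δt θ i j)) (x j)) v ω =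
      (weight θ i j • liftInvS T Δt θ ω i) * cpsd T (x j) v ω := fun j => by
    obtain ⟨hs, hz⟩ := invZ_transfer hΔt h.stable i j
    rw [(hv j).cpsd_conv_left hs ω
      (fun m => hz _ (norm_node T ω m) (node_ne_neg_one hω m)), liftInvS, ← lifted_smul]
    rfl
  rw [h.input_eq i, (hv i).cpsd_sub_sum_left
    (fun j => (hv j).conv_left (invZ_transfer hΔt h.stable i j).1)]
  simp only [stateToNoise_apply h.stable hω, h1, sub_mul, Finset.sum_sub_distrib, ite_mul, one_mul,
    zero_mul, Finset.sum_ite_eq, Finset.mem_univ, if_true]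
  -- The missing term `j = i` is harmless because the diagonal weight vanishes.
  congr 1
  refine Finset.sum_subset (Finset.subset_univ _) fun j _ hj => ?_
  have hji : j = i := by simpa using hj
  rw [hji, weight_self, zero_smul, zero_mul]

theorem conjTranspose_blockPsd (hx : ∀ i j, Coherent T (x i) (x j)) (ω : ℝ) :
    (blockPsd T x ω)ᴴ = blockPsd T x ω := by
  ext1 i j
  exact ((hx j i).cpsd_symm ω).symm

theorem IsLDM.blockPsd_input [NeZero T] (hΔt : 0 < Δt) (h : IsLDM Δt T θ p x) {ω : ℝ}
    (hω : ω ∈ freqs T) :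
    blockPsd T (input Δt θ p) ω =
      stateToNoise T Δt θ ω * blockPsd T x ω * (stateToNoise T Δt θ ω)ᴴ := by
  have h1 : ∀ i j, (stateToNoise T Δt θ ω * blockPsd T x ω) i j =
      cpsd T (input Δt θ p i) (x j) ω := fun i j => by
    rw [h.cpsd_input_left hΔt (fun k => h.coherent k j) hω, Matrix.mul_apply]
    rfl
  have h2 : ∀ i j, Coherent T (input Δt θ p i) (x j) := fun i j =>
    h.coherent_input_left hΔt (fun k => h.coherent k j) i
  have h3 : stateToNoise T Δt θ ω * blockPsd T x ω * (stateToNoise T Δt θ ω)ᴴ =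
      stateToNoise T Δt θ ω * (stateToNoise T Δt θ ω * blockPsd T x ω)ᴴ := by
    rw [Matrix.conjTranspose_mul, conjTranspose_blockPsd h.coherent, mul_assoc]
  rw [h3]
  ext1 i j
  rw [Matrix.mul_apply]
  refine (h.cpsd_input_left hΔt (fun k => (h2 j k).symm) hω i).trans
    (Finset.sum_congr rfl fun k _ => ?_)
  rw [(h2 j k).cpsd_symm, Matrix.conjTranspose_apply, h1]
  rfl

theorem corr_conv_conv_eq_zero {c d : ℤ → ℂ} (hc : Summable c) (hd : Summable d)
    {u v : ℤ → Lp ℂ 2 P} (hu : ∃ C, ∀ k, ‖u k‖ ≤ C) (hv : ∃ C, ∀ k, ‖v k‖ ≤ C)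
    (h : ∀ s t, corr (u s) (v t) = 0) (s t : ℤ) : corr (conv c u s) (conv d v t) = 0 := by
  have h1 : ∀ r, corr (u r) (conv d v t) = 0 := fun r => by
    rw [← corr_conj, star_eq_zero]
    refine (hasSum_corr_conv hd hv t (u r)).unique ?_
    refine hasSum_zero.congr_fun fun n => ?_
    rw [← corr_conj, h, star_zero, mul_zero]
  refine (hasSum_corr_conv hc hu s _).unique (hasSum_zero.congr_fun fun n => ?_)
  rw [h1, mul_zero]

/-- The second expression for the input spectrum, from `p` instead of `x`; equating the two yields
the inverse of the state spectrum. -/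
theorem blockPsd_input_eq_diagonal [NeZero T] (hΔt : 0 < Δt) (h : Stable Δt θ)
    (hp : ∀ i, Coherent T (p i) (p i))
    (huncorr : ∀ i j, i ≠ j → ∀ s t, corr (p i s) (p j t) = 0) {ω : ℝ} (hω : ω ∈ freqs T) :
    blockPsd T (input Δt θ p) ω = Matrix.diagonal (liftInvS T Δt θ ω) *
      Matrix.diagonal (fun i => cpsd T (p i) (p i) ω) *
        (Matrix.diagonal (liftInvS T Δt θ ω))ᴴ := by
  rw [Matrix.diagonal_conjTranspose, Matrix.diagonal_mul_diagonal, Matrix.diagonal_mul_diagonal]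
  ext1 i j
  have hg := fun i => invZ_inv_sysS hΔt h i
  have hd : ∀ (i : V) (m : Fin T), HasSum (fun n : ℤ => invZ (fun z => (sysS Δt θ i z)⁻¹) n *
      node T ω m ^ (-n)) (sysS Δt θ i (node T ω m))⁻¹ := fun i m =>
    (hg i).2 _ (norm_node T ω m) (node_ne_neg_one hω m)
  by_cases hij : i = j
  · subst hij
    rw [Matrix.diagonal_apply_eq]
    change cpsd T (conv _ (p i)) (conv _ (p i)) ω = _
    rw [((hp i).conv_left (hg i).1).cpsd_conv_right (hg i).1 ω (hd i),
      (hp i).cpsd_conv_left (hg i).1 ω (hd i)]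
    rfl
  · rw [Matrix.diagonal_apply_ne _ hij]
    ext s t
    change ∑' k : ℤ, corr (conv _ (p i) _) (conv _ (p j) _) * _ = 0
    simp only [corr_conv_conv_eq_zero (hg i).1 (hg j).1 (hp i).bdd_left (hp j).bdd_left
      (huncorr i j hij), zero_mul, tsum_zero]

theorem isUnit_liftInvS [NeZero T] (h : Stable Δt θ) {ω : ℝ} (hω : ω ∈ freqs T) (i : V) :
    IsUnit (liftInvS T Δt θ ω i) :=
  isUnit_iff_exists.2 ⟨_, liftInvS_mul_liftS h hω i, liftS_mul_liftInvS h hω i⟩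

/-- Detectability concerns `e_i = p_i / S_i`; congruence by the invertible lift of `1 / S_i` carries
it over to `p_i`. -/
theorem IsLDM.posDef_cpsd [NeZero T] (hΔt : 0 < Δt) (h : IsLDM Δt T θ p x)
    (hp : ∀ i, Coherent T (p i) (p i)) {ω : ℝ} (hω : ω ∈ freqs T) (i : V) :
    (cpsd T (p i) (p i) ω).PosDef := by
  have hg := invZ_inv_sysS hΔt h.stable i
  have hd : ∀ (m : Fin T), HasSum (fun n : ℤ => invZ (fun z => (sysS Δt θ i z)⁻¹) n *
      node T ω m ^ (-n)) (sysS Δt θ i (node T ω m))⁻¹ := fun m =>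
    hg.2 _ (norm_node T ω m) (node_ne_neg_one hω m)
  have h1 : psd (lift T (input Δt θ p i)) ω =
      liftInvS T Δt θ ω i * cpsd T (p i) (p i) ω * star (liftInvS T Δt θ ω i) := by
    change cpsd T (conv _ (p i)) (conv _ (p i)) ω = _
    rw [((hp i).conv_left hg.1).cpsd_conv_right hg.1 ω hd, (hp i).cpsd_conv_left hg.1 ω hd]
    rfl
  have h2 := h.detectable i ω hω
  rw [h1] at h2
  exact (Matrix.IsUnit.posDef_star_right_conjugate_iff (isUnit_liftInvS h.stable hω i)).1 h2

theorem IsLDM.precision_mul_blockPsd [NeZero T] (hΔt : 0 < Δt) (h : IsLDM Δt T θ p x)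
    (hp : ∀ i, Coherent T (p i) (p i))
    (huncorr : ∀ i j, i ≠ j → ∀ s t, corr (p i s) (p j t) = 0) {ω : ℝ} (hω : ω ∈ freqs T) :
    precision T Δt θ p ω * blockPsd T x ω = 1 := by
  set N := stateToInput T Δt θ ω with hN
  set D := Matrix.diagonal (liftInvS T Δt θ ω) with hD
  set D' := Matrix.diagonal (liftS T Δt θ ω) with hD'
  set Pm := Matrix.diagonal (fun i => cpsd T (p i) (p i) ω) with hPm
  set Qm := Matrix.diagonal (fun i => (cpsd T (p i) (p i) ω)⁻¹) with hQm
  set X := blockPsd T x ω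
  have h1 : D' * D = 1 := by
    rw [hD, hD', Matrix.diagonal_mul_diagonal, ← Matrix.diagonal_one]
    congr 1
    funext i
    exact liftS_mul_liftInvS h.stable hω i
  have h2 : D * N * X * (D * N)ᴴ = D * Pm * Dᴴ :=
    (h.blockPsd_input hΔt hω).symm.trans (blockPsd_input_eq_diagonal hΔt h.stable hp huncorr hω)
  have h3 : Dᴴ * D'ᴴ = 1 := by rw [← Matrix.conjTranspose_mul, h1, Matrix.conjTranspose_one]
  have h4 : N * X * Nᴴ = Pm := by
    have h5 : D' * (D * N * X * (D * N)ᴴ) * D'ᴴ = D' * (D * Pm * Dᴴ) * D'ᴴ := by rw [h2]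
    have h6 : D' * (D * N * X * (D * N)ᴴ) * D'ᴴ = (D' * D) * (N * X * Nᴴ) * (Dᴴ * D'ᴴ) := by
      rw [Matrix.conjTranspose_mul]; simp only [mul_assoc]
    have h7 : D' * (D * Pm * Dᴴ) * D'ᴴ = (D' * D) * Pm * (Dᴴ * D'ᴴ) := by simp only [mul_assoc]
    rw [h6, h7, h1, h3] at h5
    simpa only [one_mul, mul_one] using h5
  have h8 : Pm * Qm = 1 := by
    rw [hPm, hQm, Matrix.diagonal_mul_diagonal, ← Matrix.diagonal_one]
    congr 1
    funext i
    exact Matrix.mul_nonsing_inv _ ((Matrix.isUnit_iff_isUnit_det _).1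
      (h.posDef_cpsd hΔt hp hω i).isUnit)
  -- Invertibility of `N` is not assumed: `N X N* = Φ_P` gives a one-sided inverse, and for square
  -- matrices the factors may be rotated.
  have h9 : N * (X * Nᴴ * Qm) = 1 := by rw [← mul_assoc, ← mul_assoc, h4, h8]
  have h10 := mul_eq_one_comm.1 h9
  refine mul_eq_one_comm.1 (Eq.trans ?_ h10)
  rw [precision]
  simp only [mul_assoc]
  rfl

theorem compRingEquiv_conjTranspose {T : ℕ} (M : Matrix V V (Matrix (Fin T) (Fin T) ℂ)) :
    Matrix.compRingEquiv V (Fin T) ℂ Mᴴ = (Matrix.compRingEquiv V (Fin T) ℂ M)ᴴ := rfl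

theorem IsLDM.comp_precision_mul_psd [NeZero T] (hΔt : 0 < Δt) (h : IsLDM Δt T θ p x)
    (hp : ∀ i, Coherent T (p i) (p i))
    (huncorr : ∀ i j, i ≠ j → ∀ s t, corr (p i s) (p j t) = 0) {ω : ℝ} (hω : ω ∈ freqs T) :
    Matrix.compRingEquiv V (Fin T) ℂ (precision T Δt θ p ω) * psd (liftAll T x) ω = 1 := by
  have h1 := congrArg (Matrix.compRingEquiv V (Fin T) ℂ)
    (h.precision_mul_blockPsd hΔt hp huncorr hω)
  rwa [map_mul, map_one] at h1

theorem IsLDM.posDef_psd [NeZero T] (hΔt : 0 < Δt) (h : IsLDM Δt T θ p x)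
    (hp : ∀ i, Coherent T (p i) (p i))
    (huncorr : ∀ i j, i ≠ j → ∀ s t, corr (p i s) (p j t) = 0) {ω : ℝ} (hω : ω ∈ freqs T) :
    (psd (liftAll T x) ω).PosDef := by
  have h1 := h.comp_precision_mul_psd hΔt hp huncorr hω
  have h2 : (Matrix.compRingEquiv V (Fin T) ℂ (precision T Δt θ p ω)).PosDef := by
    have h3 : Matrix.compRingEquiv V (Fin T) ℂ (precision T Δt θ p ω) =
        (Matrix.compRingEquiv V (Fin T) ℂ (stateToInput T Δt θ ω))ᴴ *
          Matrix.compRingEquiv V (Fin T) ℂ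
            (Matrix.diagonal fun i => (cpsd T (p i) (p i) ω)⁻¹) *
          Matrix.compRingEquiv V (Fin T) ℂ (stateToInput T Δt θ ω) := by
      rw [precision, map_mul, map_mul, compRingEquiv_conjTranspose]
    rw [h3]
    refine (posDef_comp_diagonal fun i =>
      (h.posDef_cpsd hΔt hp hω i).inv).conjTranspose_mul_mul_same
        (Matrix.mulVec_injective_of_isUnit ?_)
    rw [h3] at h1
    have h4 := mul_eq_one_comm.1 h1
    rw [← mul_assoc] at h4
    exact IsUnit.of_mul_eq_one_right _ h4
  have h5 : psd (liftAll T x) ω =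
      (Matrix.compRingEquiv V (Fin T) ℂ (precision T Δt θ p ω))⁻¹ :=
    (Matrix.inv_eq_right_inv h1).symm
  rw [h5]
  exact h2.inv

end Model

/-! ### Constant phase of matrices -/

/-- Rayleigh quotient: `κ v*Qv = μ v*v` for an eigenvector `v`, with both quadratic forms positive.
-/
theorem eigenvalue_smul_posDef {n : Type*} [Fintype n] [DecidableEq n] {Q : Matrix n n ℂ}
    (hQ : Q.PosDef) {κ : ℂ} {μ : ℂ}
    (hμ : Module.End.HasEigenvalue (Matrix.toLin' (κ • Q)) μ) : ∃ r : ℝ, 0 < r ∧ μ = r * κ := by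
  obtain ⟨v, hv⟩ := hμ.exists_hasEigenvector
  have h1 : κ • (Q *ᵥ v) = μ • v := by
    simpa [Matrix.smul_mulVec] using hv.apply_eq_smul
  have h2 : κ * (star v ⬝ᵥ (Q *ᵥ v)) = μ * (star v ⬝ᵥ v) := by
    have := congrArg (star v ⬝ᵥ ·) h1
    simpa [dotProduct_smul] using this
  have h3 := Complex.pos_iff.1 (hQ.dotProduct_mulVec_pos hv.2)
  have h4 := Complex.pos_iff.1 (dotProduct_comm v (star v) ▸
    Matrix.dotProduct_star_self_pos_iff.2 hv.2 : 0 < star v ⬝ᵥ v)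
  have h5 : (star v ⬝ᵥ (Q *ᵥ v)) = ((star v ⬝ᵥ (Q *ᵥ v)).re : ℂ) :=
    Complex.ext rfl h3.2.symm
  have h6 : (star v ⬝ᵥ v) = ((star v ⬝ᵥ v).re : ℂ) := Complex.ext rfl h4.2.symm
  rw [h5, h6] at h2
  refine ⟨_, div_pos h3.1 h4.1, ?_⟩
  have h7 : ((star v ⬝ᵥ v).re : ℂ) ≠ 0 := Complex.ofReal_ne_zero.2 h4.1.ne'
  push_cast
  field_simp
  linear_combination -h2

/-! ### Structure of the precision matrix -/

section Precision

set_option linter.unusedSectionVars false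

variable {V : Type*} [Fintype V] [DecidableEq V] {G : SimpleGraph V} {l : ℕ} {Δt : ℝ} {T : ℕ}
  {Ω : Type*} [MeasurableSpace Ω] {P : Measure Ω}

theorem stateToInput_of_ne (T : ℕ) (Δt : ℝ) (θ : Params G l) (ω : ℝ) {k i : V} (h : k ≠ i) :
    stateToInput T Δt θ ω k i = -(weight θ k i • 1) := by
  rw [stateToInput, Matrix.sub_apply, Matrix.diagonal_apply_ne _ h, zero_sub, Matrix.of_apply]

theorem stateToInput_self (T : ℕ) (Δt : ℝ) (θ : Params G l) (ω : ℝ) (i : V) :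
    stateToInput T Δt θ ω i i = liftS T Δt θ ω i := by
  rw [stateToInput, Matrix.sub_apply, Matrix.diagonal_apply_eq, Matrix.of_apply, weight_self,
    zero_smul, sub_zero]

theorem stateToInput_eq_zero (T : ℕ) (Δt : ℝ) (θ : Params G l) (ω : ℝ) {k i : V} (h : k ≠ i)
    (hadj : ¬ G.Adj k i) : stateToInput T Δt θ ω k i = 0 := by
  rw [stateToInput_of_ne T Δt θ ω h, weight, dif_neg hadj, zero_smul, neg_zero]

/-- A summand `k` survives only if `k` is within one hop of both `i` and `j`. -/
theorem precision_eq_zero (T : ℕ) (Δt : ℝ) (θ : Params G l) (p : V → ℤ → Lp ℂ 2 P) (ω : ℝ)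
    {i j : V} (hij : G.Connected) (h : 3 ≤ G.dist i j) : precision T Δt θ p ω i j = 0 := by
  rw [precision_apply]
  refine Finset.sum_eq_zero fun k _ => ?_
  have hd : ∀ k i, stateToInput T Δt θ ω k i ≠ 0 → G.dist k i ≤ 1 := by
    intro k i hk
    by_contra hlt
    refine hk (stateToInput_eq_zero T Δt θ ω ?_ ?_)
    · rintro rfl; simp at hlt
    · intro hadj; exact hlt (SimpleGraph.dist_eq_one_iff_adj.2 hadj).le
  by_cases hi : stateToInput T Δt θ ω k i = 0
  · rw [hi, Matrix.conjTranspose_zero, zero_mul, zero_mul]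
  by_cases hj : stateToInput T Δt θ ω k j = 0
  · rw [hj, mul_zero]
  have h1 := hij.dist_triangle (u := i) (v := k) (w := j)
  have h2 := hd k i hi
  rw [SimpleGraph.dist_comm] at h2
  have h3 := hd k j hj
  omega

theorem IsLeaf.eq_of_adj {v w w' : V} (h : IsLeaf G v) (hw : G.Adj v w) (hw' : G.Adj v w') :
    w = w' := by
  obtain ⟨u, hu⟩ := Set.ncard_eq_one.1 h
  have h1 : w ∈ G.neighborSet v := hw
  have h2 : w' ∈ G.neighborSet v := hw'
  rw [hu] at h1 h2
  exact h1.trans h2.symm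

/-- Column `a` of `S - B` is supported on the leaf and its neighbour, and the leaf's own term dies
since `b` is not adjacent to it. Both remaining outer factors are scalars, so definiteness of the
middle one survives. -/
theorem precision_of_two_hop (θ : Params G l) (p : V → ℤ → Lp ℂ 2 P) (ω : ℝ) {a b k : V}
    (ha : IsLeaf G a) (hab : a ≠ b) (hak : G.Adj a k) (hkb : G.Adj k b) :
    precision T Δt θ p ω a b =
      (star (weight θ k a) * weight θ k b) • (cpsd T (p k) (p k) ω)⁻¹ := by
  have hnab : ¬ G.Adj a b := fun h => hkb.ne (ha.eq_of_adj hak h)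
  rw [precision_apply, Finset.sum_eq_single k]
  · rw [stateToInput_of_ne T Δt θ ω hak.ne', stateToInput_of_ne T Δt θ ω hkb.ne]
    simp [Matrix.conjTranspose_smul, smul_smul, mul_comm]
  · intro j _ hjk
    by_cases hja : j = a
    · subst hja
      rw [stateToInput_eq_zero T Δt θ ω hab hnab, mul_zero]
    · rw [stateToInput_eq_zero T Δt θ ω hja fun h => hjk (ha.eq_of_adj h.symm hak),
        Matrix.conjTranspose_zero, zero_mul, zero_mul]
  · simp

/-- Minus the block of the precision matrix which belongs to a leaf `a` and its neighbour `b`. -/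
def adjBlock (T : ℕ) (Δt : ℝ) (A B : Matrix (Fin T) (Fin T) ℂ) (a b : V) (ω : ℝ)
    (θ : Params G l) : Matrix (Fin T) (Fin T) ℂ :=
  weight θ a b • ((liftS T Δt θ ω a)ᴴ * A) + star (weight θ b a) • (B * liftS T Δt θ ω b)

/-- Now both `k = a` and `k = b` contribute, each with one dynamic factor `S`, so no definiteness is
forced. -/
theorem precision_of_adj (θ : Params G l) (p : V → ℤ → Lp ℂ 2 P) (ω : ℝ) {a b : V}
    (ha : IsLeaf G a) (hab : G.Adj a b) :
    precision T Δt θ p ω a b = -adjBlock T Δt (cpsd T (p a) (p a) ω)⁻¹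
      (cpsd T (p b) (p b) ω)⁻¹ a b ω θ := by
  rw [precision_apply, ← Finset.sum_subset (Finset.subset_univ {a, b}), Finset.sum_pair hab.ne,
    stateToInput_self, stateToInput_self, stateToInput_of_ne T Δt θ ω hab.ne,
    stateToInput_of_ne T Δt θ ω hab.ne', adjBlock]
  · simp [Matrix.conjTranspose_smul]
    abel
  · intro k _ hk
    simp only [Finset.mem_insert, Finset.mem_singleton, not_or] at hk
    rw [stateToInput_eq_zero T Δt θ ω hk.1 fun h => hk.2 (ha.eq_of_adj h.symm hab),
      Matrix.conjTranspose_zero, zero_mul, zero_mul]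

theorem IsLDM.weight_ne_zero {θ : Params G l} {p x : V → ℤ → Lp ℂ 2 P} (h : IsLDM Δt T θ p x)
    {i j : V} (hij : G.Adj i j) : weight θ i j ≠ 0 := by
  intro h0
  have h1 : transfer Δt θ i j = 0 := by
    funext z
    rw [transfer, h0, zero_div]
    rfl
  have h2 : (topology Δt θ).Adj i j := by rw [h.topology_eq]; exact hij
  rw [topology, SimpleGraph.fromRel_adj] at h2
  exact h2.2.elim (fun h3 => h3 h1) fun h3 => h.bidirected i j h3 h1

end Precision

/-! ### Genericity -/

section Generic

set_option linter.unusedSectionVars false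

variable {V : Type*} [Fintype V] [DecidableEq V] {G : SimpleGraph V} [DecidableRel G.Adj] {l : ℕ}
  {T : ℕ}

theorem analyticAt_weight (i j : V) (θ : Params G l) :
    AnalyticAt ℝ (fun θ : Params G l => weight θ i j) θ := by
  by_cases h : G.Adj i j
  · simp only [weight, dif_pos h]
    exact ((ContinuousLinearMap.proj (R := ℝ) (φ := fun _ : G.Dart => ℂ) ⟨(i, j), h⟩).comp
      (ContinuousLinearMap.snd ℝ (V → Fin (l + 1) → ℂ) (G.Dart → ℂ))).analyticAt θ
  · simp only [weight, dif_neg h]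
    exact analyticAt_const

theorem analyticAt_liftS (Δt : ℝ) (i : V) (ω : ℝ) (s t : Fin T) (θ : Params G l) :
    AnalyticAt ℝ (fun θ : Params G l => liftS T Δt θ ω i s t) θ := by
  simp only [liftS, lifted, Matrix.mul_apply (N := dft T ω), Matrix.mul_diagonal, sysS]
  have h : ∀ n, AnalyticAt ℝ (fun θ : Params G l => θ.1 i n) θ := fun n =>
    ((ContinuousLinearMap.proj (R := ℝ) (φ := fun _ : Fin (l + 1) => ℂ) n).comp
      ((ContinuousLinearMap.proj (R := ℝ) (φ := fun _ : V => Fin (l + 1) → ℂ) i).comp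
        (ContinuousLinearMap.fst ℝ (V → Fin (l + 1) → ℂ) (G.Dart → ℂ)))).analyticAt θ
  exact Finset.analyticAt_fun_sum _ fun m _ => (analyticAt_const.mul
    (Finset.analyticAt_fun_sum _ fun n _ => (h n).mul analyticAt_const)).mul analyticAt_const

/-- Conjugation is only `ℝ`-linear, which is why genericity is argued with real analyticity. -/
theorem analyticAt_star {E : Type*} [NormedAddCommGroup E] [NormedSpace ℝ E] {f : E → ℂ} {x : E}
    (hf : AnalyticAt ℝ f x) : AnalyticAt ℝ (fun y => star (f y)) x :=
  (Complex.conjCLE.toContinuousLinearMap.analyticAt (f x)).comp hf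

theorem analyticAt_det_adjBlock (Δt : ℝ) (A B : Matrix (Fin T) (Fin T) ℂ) (a b : V) (ω : ℝ)
    (θ : Params G l) :
    AnalyticAt ℝ (fun θ : Params G l => (adjBlock T Δt A B a b ω θ).det) θ := by
  have hentry : ∀ s t, AnalyticAt ℝ (fun θ : Params G l => adjBlock T Δt A B a b ω θ s t) θ := by
    intro s t
    simp only [adjBlock, Matrix.add_apply, Matrix.smul_apply, Matrix.mul_apply, smul_eq_mul,
      Matrix.conjTranspose_apply]
    refine ((analyticAt_weight a b θ).mul (Finset.analyticAt_fun_sum _ fun r _ =>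
      (analyticAt_star (analyticAt_liftS Δt a ω r s θ)).mul analyticAt_const)).add
      ((analyticAt_star (analyticAt_weight b a θ)).mul (Finset.analyticAt_fun_sum _ fun r _ =>
        analyticAt_const.mul (analyticAt_liftS Δt b ω r t θ)))
  simp only [Matrix.det_apply']
  exact Finset.analyticAt_fun_sum _ fun σ _ =>
    analyticAt_const.mul (Finset.analyticAt_fun_prod _ fun s _ => hentry _ _)

open Classical in
/-- Parameters for which `b` receives the states of its neighbours with weight one, all other
weights vanish, and `S_b(z) = 2 z / (z + 1)`. -/
def probeParams (G : SimpleGraph V) (l : ℕ) (Δt : ℝ) (b : V) : Params G l :=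
  (fun i n => if i = b then (if (n : ℕ) = 0 then 1 else if (n : ℕ) = 1 then (Δt / 2 : ℂ) else 0)
    else 0, fun d => if d.fst = b then 1 else 0)

/-- Since `l ≥ 1`, the polynomial `1 + (Δt/2) w` is available. The quotient is written with
differences from `0` and `-1` so that its product over the nodes telescopes into
`X_pow_sub_C_eq_prod_node`. -/
theorem sysS_probeParams (hl : 1 ≤ l) {Δt : ℝ} (hΔt : 0 < Δt) (b : V) {z : ℂ} (hz : ‖z‖ = 1)
    (hz1 : z ≠ -1) : sysS Δt (probeParams G l Δt b) b z = 2 * ((0 - z) / (-1 - z)) := by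
  obtain ⟨l, rfl⟩ := Nat.exists_eq_add_of_le' hl
  have hz2 : z + 1 ≠ 0 := fun h2 => hz1 (eq_neg_of_add_eq_zero_left h2)
  have hz3 : -1 - z ≠ 0 := fun h => hz2 (by linear_combination -h)
  have hΔ : (Δt : ℂ) ≠ 0 := Complex.ofReal_ne_zero.2 hΔt.ne'
  have h1 : sysS Δt (probeParams G (l + 1) Δt b) b z = 1 + Δt / 2 * tustin Δt z := by
    rw [sysS, Fin.sum_univ_succ, Fin.sum_univ_succ, Finset.sum_eq_zero]
    · simp [probeParams, tustin]
    · intro n _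
      simp [probeParams]
  rw [h1, tustin_eq hz]
  field_simp
  ring

theorem det_adjBlock_probeParams [NeZero T] (hl : 1 ≤ l) {Δt : ℝ} (hΔt : 0 < Δt)
    (A B : Matrix (Fin T) (Fin T) ℂ) {a b : V} (hab : G.Adj a b) {ω : ℝ} (hω : ω ∈ freqs T) :
    (adjBlock T Δt A B a b ω (probeParams G l Δt b)).det = B.det * (2 ^ T *
      (-Complex.exp (Complex.I * ω) / ((-1) ^ T - Complex.exp (Complex.I * ω)))) := by
  have h1 : weight (probeParams G l Δt b) a b = 0 := by
    simp [weight, hab, probeParams, hab.ne]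
  have h2 : weight (probeParams G l Δt b) b a = 1 := by
    simp [weight, hab.symm, probeParams]
  rw [adjBlock, h1, h2, zero_smul, zero_add, star_one, one_smul, Matrix.det_mul, liftS, det_lifted]
  simp only [sysS_probeParams hl hΔt b (norm_node T ω _) (node_ne_neg_one hω _)]
  rw [Finset.prod_mul_distrib, Finset.prod_div_distrib, ← X_pow_sub_C_eq_prod_node,
    ← X_pow_sub_C_eq_prod_node]
  simp [NeZero.ne T]

theorem exp_I_mul_pi_div_two : Complex.exp (Complex.I * (Real.pi / 2 : ℝ)) = Complex.I := by
  rw [mul_comm]; push_cast; exact Complex.exp_pi_div_two_mul_I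

theorem exp_I_mul_three_pi_div_two :
    Complex.exp (Complex.I * (3 * Real.pi / 2 : ℝ)) = -Complex.I := by
  rw [show Complex.I * ((3 * Real.pi / 2 : ℝ) : ℂ) =
    Real.pi * Complex.I + Real.pi / 2 * Complex.I by push_cast; ring, Complex.exp_add,
    Complex.exp_pi_mul_I, Complex.exp_pi_div_two_mul_I, neg_one_mul]

/-- The points `±i` avoid `(-1)^T` for either parity of `T`. -/
theorem pi_div_two_mem_freqs (T : ℕ) : Real.pi / 2 ∈ freqs T := by
  refine ⟨⟨by positivity, by linarith [Real.pi_pos]⟩, ?_⟩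
  rw [exp_I_mul_pi_div_two]
  rcases neg_one_pow_eq_or ℂ T with h | h <;> rw [h] <;> simp [Complex.ext_iff]

theorem three_pi_div_two_mem_freqs (T : ℕ) : 3 * Real.pi / 2 ∈ freqs T := by
  refine ⟨⟨by positivity, by linarith [Real.pi_pos]⟩, ?_⟩
  rw [exp_I_mul_three_pi_div_two]
  rcases neg_one_pow_eq_or ℂ T with h | h <;> rw [h] <;> simp [Complex.ext_iff]

instance isAddHaarMeasure_volume_params :
    (volume : Measure (Params G l)).IsAddHaarMeasure :=
  have : (volume : Measure (V → Fin (l + 1) → ℂ)).IsAddHaarMeasure :=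
    Measure.pi.isAddHaarMeasure _
  Measure.prod.instIsAddHaarMeasure (volume : Measure (V → Fin (l + 1) → ℂ))
    (volume : Measure (G.Dart → ℂ))

/-- Nonvanishing is tested at the probe parameters, which need not themselves satisfy the
assumptions of the model. -/
theorem ae_det_adjBlock_im_ne_zero [NeZero T] (hl : 1 ≤ l) {Δt : ℝ} (hΔt : 0 < Δt)
    (A A' B B' : Matrix (Fin T) (Fin T) ℂ) (hB : B.PosDef) (hB' : B'.PosDef) {a b : V}
    (hab : G.Adj a b) :
    ∀ᵐ θ : Params G l, ((adjBlock T Δt A B a b (Real.pi / 2) θ).det *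
      star (adjBlock T Δt A' B' a b (3 * Real.pi / 2) θ).det).im ≠ 0 := by
  refine ae_ne_zero_of_analytic_on_lines _ (x₀ := probeParams G l Δt b) (fun θ _ => ?_) ?_
  · exact (Complex.imCLM.analyticAt _).comp ((analyticAt_det_adjBlock Δt A B a b _ θ).mul
      (analyticAt_star (analyticAt_det_adjBlock Δt A' B' a b _ θ)))
  · rw [det_adjBlock_probeParams hl hΔt _ _ hab (pi_div_two_mem_freqs T),
      det_adjBlock_probeParams hl hΔt _ _ hab (three_pi_div_two_mem_freqs T),
      exp_I_mul_pi_div_two, exp_I_mul_three_pi_div_two]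
    have h1 := Complex.pos_iff.1 hB.det_pos
    have h2 := Complex.pos_iff.1 hB'.det_pos
    have h3 : B.det = (B.det.re : ℂ) := Complex.ext rfl h1.2.symm
    have h4 : B'.det = (B'.det.re : ℂ) := Complex.ext rfl h2.2.symm
    -- With `ε = (-1)^T` the two values are complex conjugates, so the product is `-1 / (ε - i)² =
    -- -(ε/2) i`, purely imaginary and nonzero.
    have h5 : ∀ ε : ℂ, ε = 1 ∨ ε = -1 → (-Complex.I / (ε - Complex.I)) *
        star (- -Complex.I / (ε - -Complex.I)) = ((-(ε.re / 2) : ℝ) : ℂ) * Complex.I := by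
      rintro ε (rfl | rfl) <;>
      · simp [Complex.ext_iff, Complex.div_re, Complex.div_im, Complex.normSq]
        norm_num
    have h6 := h5 _ (neg_one_pow_eq_or ℂ T)
    have h7 : ((2 : ℂ) ^ T) = (((2 : ℝ) ^ T : ℝ) : ℂ) := by push_cast; rfl
    have hs : ∀ r : ℝ, star (r : ℂ) = r := fun r => Complex.conj_ofReal r
    rw [h3, h4, h7, star_mul', star_mul', hs, hs]
    have h8 : ∀ (r s c : ℝ) (u v : ℂ), (r : ℂ) * (c * u) * (s * (c * v)) =
        ((r * s * c * c : ℝ) : ℂ) * (u * v) := fun r s c u v => by push_cast; ring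
    have hε : ((-1 : ℂ) ^ T).re ≠ 0 := by
      rcases neg_one_pow_eq_or ℂ T with h | h <;> rw [h] <;> simp
    rw [h8, h6, Complex.im_ofReal_mul, Complex.im_ofReal_mul, Complex.I_im, mul_one]
    have h2T : ((2 : ℝ) ^ T) ≠ 0 := by positivity
    exact mul_ne_zero (mul_ne_zero (mul_ne_zero (mul_ne_zero h1.1.ne' h2.1.ne') h2T) h2T)
      (neg_ne_zero.2 (div_ne_zero hε two_ne_zero))

end Generic

/-! ### The observed inverse spectral density -/

theorem exists_adj_adj_of_dist_eq_two {V : Type*} {G : SimpleGraph V} (hG : G.Connected) {u v : V}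
    (hd : G.dist u v = 2) : ∃ k, G.Adj u k ∧ G.Adj k v := by
  obtain ⟨w, hw⟩ := hG.exists_walk_length_eq_dist u v
  rw [hd] at hw
  match w, hw with
  | .cons h1 (.cons h2 .nil), _ => exact ⟨_, h1, h2⟩

section Observed

variable {Ω : Type*} [MeasurableSpace Ω] {P : Measure Ω}
  {Vo Vh : Type*} [Fintype Vo] [DecidableEq Vo] [Fintype Vh] [DecidableEq Vh]
  {G : SimpleGraph (Vo ⊕ Vh)} {l : ℕ} {Δt : ℝ} {T : ℕ} {θ : Params G l}
  {p x : Vo ⊕ Vh → ℤ → Lp ℂ 2 P}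

theorem IsLDM.posDef_psdObs [NeZero T] (hΔt : 0 < Δt) (h : IsLDM Δt T θ p x)
    (hp : ∀ i, Coherent T (p i) (p i))
    (huncorr : ∀ i j, i ≠ j → ∀ s t, corr (p i s) (p j t) = 0) {ω : ℝ} (hω : ω ∈ freqs T) :
    (psdObs T x ω).PosDef :=
  (h.posDef_psd hΔt hp huncorr hω).submatrix
    (e := fun q : Vo × Fin T => ((Sum.inl q.1, q.2) : (Vo ⊕ Vh) × Fin T))
    fun q q' hq => by simpa [Prod.ext_iff] using hq

theorem IsLDM.invBlock_eq [NeZero T] (hΔt : 0 < Δt) (h : IsLDM Δt T θ p x)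
    (hp : ∀ i, Coherent T (p i) (p i))
    (huncorr : ∀ i j, i ≠ j → ∀ s t, corr (p i s) (p j t) = 0) {ω : ℝ} (hω : ω ∈ freqs T)
    {a : Vo} (ha : ∀ q : Vh, precision T Δt θ p ω (Sum.inl a) (Sum.inr q) = 0) (b : Vo) :
    invBlock T x a b ω = precision T Δt θ p ω (Sum.inl a) (Sum.inl b) := by
  ext s t
  exact inv_submatrix_of_row_eq_zero (h.comp_precision_mul_psd hΔt hp huncorr hω)
    (Equiv.sumProdDistrib Vo Vh (Fin T)).symm
    (h.posDef_psdObs hΔt hp huncorr hω).isUnit (a := (a, s))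
    (fun q => congrFun (congrFun (ha q.1) s) q.2) (b, t)

theorem IsLDM.invBlock_symm [NeZero T] (hΔt : 0 < Δt) (h : IsLDM Δt T θ p x)
    (hp : ∀ i, Coherent T (p i) (p i))
    (huncorr : ∀ i j, i ≠ j → ∀ s t, corr (p i s) (p j t) = 0) {ω : ℝ} (hω : ω ∈ freqs T)
    (a b : Vo) : invBlock T x b a ω = (invBlock T x a b ω)ᴴ := by
  ext s t
  exact ((h.posDef_psdObs hΔt hp huncorr hω).inv.isHermitian.apply (b, s) (a, t)).symm

theorem IsLDM.dist_le_two [NeZero T] (hΔt : 0 < Δt) (h : IsLDM Δt T θ p x)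
    (hp : ∀ i, Coherent T (p i) (p i))
    (huncorr : ∀ i j, i ≠ j → ∀ s t, corr (p i s) (p j t) = 0) (hG : G.Connected)
    {a b : Vo} (ha : ∀ q : Vh, 3 ≤ G.dist (Sum.inl a) (Sum.inr q)) (hab : (obsGraph T x).Adj a b) :
    a ≠ b ∧ G.dist (Sum.inl a) (Sum.inl b) ≤ 2 := by
  rw [obsGraph, SimpleGraph.fromRel_adj] at hab
  refine ⟨hab.1, ?_⟩
  by_contra! hlt
  have h0 : ∀ ω ∈ freqs T, invBlock T x a b ω = 0 := fun ω hω => by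
    rw [h.invBlock_eq hΔt hp huncorr hω fun q => precision_eq_zero T Δt θ p ω hG (ha q)]
    exact precision_eq_zero T Δt θ p ω hG hlt
  -- Either orientation of the block may witness the edge; Hermitian symmetry reduces the second to
  -- the first.
  rcases hab.2 with ⟨ω, hω, hne⟩ | ⟨ω, hω, hne⟩
  · exact hne (h0 ω hω)
  · exact hne (by rw [h.invBlock_symm hΔt hp huncorr hω, h0 ω hω, Matrix.conjTranspose_zero])

theorem IsLDM.eigenvalue_invBlock_of_dist_eq_two [NeZero T] (hΔt : 0 < Δt)
    (h : IsLDM Δt T θ p x) (hp : ∀ i, Coherent T (p i) (p i))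
    (huncorr : ∀ i j, i ≠ j → ∀ s t, corr (p i s) (p j t) = 0) (hG : G.Connected)
    {a b : Vo} (hleaf : IsLeaf G (Sum.inl a))
    (ha : ∀ q : Vh, 3 ≤ G.dist (Sum.inl a) (Sum.inr q))
    (hd : G.dist (Sum.inl a) (Sum.inl b) = 2) :
    ∃ κ : ℂ, κ ≠ 0 ∧ ∀ ω ∈ freqs T, ∀ μ : ℂ,
      Module.End.HasEigenvalue (Matrix.toLin' (invBlock T x a b ω)) μ →
        ∃ r : ℝ, 0 < r ∧ μ = r * κ := by
  obtain ⟨k, hak, hkb⟩ := exists_adj_adj_of_dist_eq_two hG hd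
  have hab : (Sum.inl a : Vo ⊕ Vh) ≠ Sum.inl b := fun h0 => by
    rw [h0, SimpleGraph.dist_self] at hd
    exact absurd hd (by norm_num)
  -- The scalar is independent of `ω`; only the positive definite factor varies.
  refine ⟨star (weight θ k (Sum.inl a)) * weight θ k (Sum.inl b),
    mul_ne_zero (star_ne_zero.2 (h.weight_ne_zero hak.symm)) (h.weight_ne_zero hkb), ?_⟩
  intro ω hω μ hμ
  rw [h.invBlock_eq hΔt hp huncorr hω fun q => precision_eq_zero T Δt θ p ω hG (ha q),
    precision_of_two_hop θ p ω hleaf hab hak hkb] at hμ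
  exact eigenvalue_smul_posDef (h.posDef_cpsd hΔt hp hω k).inv hμ

theorem IsLDM.det_adjBlock_im_eq_zero [NeZero T] (hΔt : 0 < Δt)
    (h : IsLDM Δt T θ p x) (hp : ∀ i, Coherent T (p i) (p i))
    (huncorr : ∀ i j, i ≠ j → ∀ s t, corr (p i s) (p j t) = 0) (hG : G.Connected)
    {a b : Vo} (hleaf : IsLeaf G (Sum.inl a))
    (ha : ∀ q : Vh, 3 ≤ G.dist (Sum.inl a) (Sum.inr q)) (hab : G.Adj (Sum.inl a) (Sum.inl b))
    (hphase : ConstantPhase T (invBlock T x a b)) {ω ω' : ℝ} (hω : ω ∈ freqs T)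
    (hω' : ω' ∈ freqs T) :
    ((adjBlock T Δt (cpsd T (p (.inl a)) (p (.inl a)) ω)⁻¹ (cpsd T (p (.inl b)) (p (.inl b)) ω)⁻¹
        (.inl a) (.inl b) ω θ).det *
      star (adjBlock T Δt (cpsd T (p (.inl a)) (p (.inl a)) ω')⁻¹
        (cpsd T (p (.inl b)) (p (.inl b)) ω')⁻¹ (.inl a) (.inl b) ω' θ).det).im = 0 := by
  obtain ⟨c, hc⟩ := hphase
  have hdet : ∀ ω ∈ freqs T, ∃ r : ℝ, (adjBlock T Δt (cpsd T (p (.inl a)) (p (.inl a)) ω)⁻¹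
      (cpsd T (p (.inl b)) (p (.inl b)) ω)⁻¹ (.inl a) (.inl b) ω θ).det =
        r * ((-1) ^ T * Complex.exp (Complex.I * c) ^ T) := by
    intro ω hω
    obtain ⟨r, hr⟩ := det_of_eigenvalues_arg_eq _ (hc ω hω)
    rw [h.invBlock_eq hΔt hp huncorr hω fun q => precision_eq_zero T Δt θ p ω hG (ha q),
      precision_of_adj θ p ω hleaf hab, Matrix.det_neg, Fintype.card_fin] at hr
    refine ⟨r, ?_⟩
    -- The factor `(-1)^T` compensates for the block being minus `adjBlock`.
    rw [mul_left_comm, ← hr, ← mul_assoc, ← mul_pow, neg_one_mul, neg_neg, one_pow, one_mul]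
  obtain ⟨r, hr⟩ := hdet ω hω
  obtain ⟨r', hr'⟩ := hdet ω' hω'
  rw [hr, hr', star_mul', mul_mul_mul_comm, Complex.star_def,
    Complex.conj_ofReal, Complex.mul_conj, ← Complex.ofReal_mul, ← Complex.ofReal_mul,
    Complex.ofReal_im]

theorem ae_not_constantPhase_of_adj [NeZero T] [DecidableRel G.Adj] (hl : 1 ≤ l) (hΔt : 0 < Δt)
    (hp : ∀ i, Coherent T (p i) (p i))
    (huncorr : ∀ i j, i ≠ j → ∀ s t, corr (p i s) (p j t) = 0) (hG : G.Connected)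
    {a b : Vo} (hleaf : IsLeaf G (Sum.inl a))
    (ha : ∀ q : Vh, 3 ≤ G.dist (Sum.inl a) (Sum.inr q)) (hab : G.Adj (Sum.inl a) (Sum.inl b)) :
    ∀ᵐ θ : Params G l, ∀ x : Vo ⊕ Vh → ℤ → Lp ℂ 2 P, IsLDM Δt T θ p x →
      ¬ ConstantPhase T (invBlock T x a b) := by
  -- The input spectra do not depend on the parameters, so one valid model anywhere provides their
  -- positive definiteness; with none, the claim is vacuous.
  by_cases hex : ∃ (θ : Params G l) (x : Vo ⊕ Vh → ℤ → Lp ℂ 2 P), IsLDM Δt T θ p x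
  · obtain ⟨θ₀, x₀, h₀⟩ := hex
    filter_upwards [ae_det_adjBlock_im_ne_zero hl hΔt _ _ _ _
      (h₀.posDef_cpsd hΔt hp (pi_div_two_mem_freqs T) (Sum.inl b)).inv
      (h₀.posDef_cpsd hΔt hp (three_pi_div_two_mem_freqs T) (Sum.inl b)).inv hab]
      with θ hθ x hx hphase
    exact hθ (hx.det_adjBlock_im_eq_zero hΔt hp huncorr hG hleaf ha hab hphase
      (pi_div_two_mem_freqs T) (three_pi_div_two_mem_freqs T))
  · exact Filter.Eventually.of_forall fun θ x hx => absurd ⟨θ, x, hx⟩ hex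

end Observed

theorem IsWSCS.coherent {Ω : Type*} [MeasurableSpace Ω] {P : Measure Ω} {T τ : ℕ} [NeZero T]
    {y : ℤ → Lp ℂ 2 P} (hy : IsWSCS τ y) (hτ : τ ∣ T) (hpsd : HasPSD (lift T y)) :
    Coherent T y y := by
  obtain ⟨q, rfl⟩ := hτ
  have hper : ∀ s t : ℤ, corr (y (s + (τ * q : ℕ))) (y (t + (τ * q : ℕ))) = corr (y s) (y t) := by
    intro s t
    rw [← periodic_mul (T := τ) (fun s t => hy.1.2.2 () () s t) q s t]
    congr 2 <;> · push_cast; ring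
  exact .of_summable_lift (bounded_of_periodic hper) (bounded_of_periodic hper) hper hpsd

end CycloLDM

end

/-! ### The main theorem -/

theorem mainTheorem8
    {Ω : Type*} [MeasurableSpace Ω] (P : Measure Ω) [IsProbabilityMeasure P]
    {Vo Vh : Type*} [Fintype Vo] [DecidableEq Vo] [Fintype Vh] [DecidableEq Vh]
    -- the topology: a tree with observed nodes `Vo` and hidden nodes `Vh`
    (G : SimpleGraph (Vo ⊕ Vh)) [DecidableRel G.Adj] (hG : G.IsTree)
    (hHidden : ∀ h h' : Vh, h ≠ h' → 4 ≤ G.dist (Sum.inr h) (Sum.inr h'))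
    (hLeaf : ∀ (h : Vh) (v : Vo ⊕ Vh), CycloLDM.IsLeaf G v → 3 ≤ G.dist (Sum.inr h) v)
    -- order of the differential equations and sampling period
    (l : ℕ) (hl : 1 ≤ l) (Δt : ℝ) (hΔt : 0 < Δt)
    -- the exogenous inputs
    (p : Vo ⊕ Vh → ℤ → Lp ℂ 2 P) (per : Vo ⊕ Vh → ℕ)
    (hmean : ∀ i k, CycloLDM.mean (p i k) = 0)
    (hper : ∀ i, CycloLDM.IsWSCS (per i) (p i))
    (huncorr : ∀ i j, i ≠ j → ∀ s t, CycloLDM.corr (p i s) (p j t) = 0)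
    (T : ℕ) (hT : T = Finset.univ.lcm fun i : Vo => per (Sum.inl i))
    (hperHidden : ∀ h : Vh, per (Sum.inr h) ∣ T)
    (hpsd : ∀ i, CycloLDM.HasPSD (CycloLDM.lift T (p i))) :
    -- two-hop neighbours have constant phase, for all system parameters
    (∀ (θ : CycloLDM.Params G l) (x : Vo ⊕ Vh → ℤ → Lp ℂ 2 P), CycloLDM.IsLDM Δt T θ p x →
      ∀ a b : Vo, CycloLDM.IsLeaf G (Sum.inl a) → ¬ CycloLDM.IsLeaf G (Sum.inl b) →
        (CycloLDM.obsGraph T x).Adj a b → G.dist (Sum.inl a) (Sum.inl b) = 2 →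
          CycloLDM.ConstantPhase T (CycloLDM.invBlock T x a b) ∧
          ∀ ω ∈ CycloLDM.freqs T, ¬ Module.End.HasEigenvalue
            (Matrix.toLin' (CycloLDM.invBlock T x a b ω)) 0) ∧
    -- for almost all system parameters, constant phase characterizes two-hop neighbours
    (∀ᵐ θ : CycloLDM.Params G l, ∀ x : Vo ⊕ Vh → ℤ → Lp ℂ 2 P, CycloLDM.IsLDM Δt T θ p x →
      ∀ a b : Vo, CycloLDM.IsLeaf G (Sum.inl a) → ¬ CycloLDM.IsLeaf G (Sum.inl b) →
        (CycloLDM.obsGraph T x).Adj a b →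
          (CycloLDM.ConstantPhase T (CycloLDM.invBlock T x a b) ↔
            G.dist (Sum.inl a) (Sum.inl b) = 2)) := by
  have hdvd : ∀ i, per i ∣ T := by
    rintro (i | h)
    · rw [hT]
      exact Finset.dvd_lcm (Finset.mem_univ i)
    · exact hperHidden h
  have : NeZero T := ⟨by
    rw [hT, Ne, Finset.lcm_eq_zero_iff]
    simp only [Finset.mem_univ, true_and, not_exists]
    exact fun i => (hper (Sum.inl i)).1.1.ne'⟩
  have hp : ∀ i, CycloLDM.Coherent T (p i) (p i) := fun i =>
    (hper i).coherent (hdvd i) (hpsd i)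
  have hfar : ∀ a : Vo, CycloLDM.IsLeaf G (Sum.inl a) →
      ∀ q : Vh, 3 ≤ G.dist (Sum.inl a) (Sum.inr q) := fun a ha q => by
    rw [SimpleGraph.dist_comm]
    exact hLeaf q _ ha
  have htwo : ∀ (θ : CycloLDM.Params G l) (x : Vo ⊕ Vh → ℤ → Lp ℂ 2 P),
      CycloLDM.IsLDM Δt T θ p x → ∀ a b : Vo, CycloLDM.IsLeaf G (Sum.inl a) →
        G.dist (Sum.inl a) (Sum.inl b) = 2 →
          CycloLDM.ConstantPhase T (CycloLDM.invBlock T x a b) ∧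
          ∀ ω ∈ CycloLDM.freqs T, ¬ Module.End.HasEigenvalue
            (Matrix.toLin' (CycloLDM.invBlock T x a b ω)) 0 := by
    intro θ x hx a b ha hd
    obtain ⟨κ, hκ, hev⟩ := hx.eigenvalue_invBlock_of_dist_eq_two hΔt hp huncorr hG.connected ha
      (hfar a ha) hd
    refine ⟨⟨κ.arg, fun ω hω μ hμ _ => ?_⟩, fun ω hω h0 => ?_⟩
    · obtain ⟨r, hr, rfl⟩ := hev ω hω μ hμ
      exact Complex.arg_real_mul κ hr
    · obtain ⟨r, hr, h1⟩ := hev ω hω 0 h0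
      exact mul_ne_zero (Complex.ofReal_ne_zero.2 hr.ne') hκ h1.symm
  refine ⟨fun θ x hx a b ha _ _ hd => htwo θ x hx a b ha hd, ?_⟩
  -- Finitely many pairs `(a, b)` are united into one null set; the solution `x` stays inside the
  -- almost-everywhere statement because the exceptional set does not depend on it.
  have hall : ∀ᵐ θ : CycloLDM.Params G l, ∀ a b : Vo, G.Adj (Sum.inl a) (Sum.inl b) →
      CycloLDM.IsLeaf G (Sum.inl a) → ∀ x : Vo ⊕ Vh → ℤ → Lp ℂ 2 P,
        CycloLDM.IsLDM Δt T θ p x → ¬ CycloLDM.ConstantPhase T (CycloLDM.invBlock T x a b) := by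
    simp only [ae_all_iff, Filter.eventually_imp_distrib_left]
    exact fun a b hab ha =>
      CycloLDM.ae_not_constantPhase_of_adj hl hΔt hp huncorr hG.connected ha (hfar a ha) hab
  filter_upwards [hall] with θ hθ x hx a b ha _ hab
  refine ⟨fun hphase => ?_, fun hd => (htwo θ x hx a b ha hd).1⟩
  obtain ⟨hne, hle⟩ := hx.dist_le_two hΔt hp huncorr hG.connected (hfar a ha) hab
  have h0 : G.dist (Sum.inl a) (Sum.inl b) ≠ 0 := fun h0 =>
    hne (Sum.inl_injective (hG.connected.dist_eq_zero_iff.1 h0))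
  have h1 : G.dist (Sum.inl a) (Sum.inl b) ≠ 1 := fun h1 =>
    hθ a b (SimpleGraph.dist_eq_one_iff_adj.1 h1) ha x hx hphase
  omega
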